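/- Let $d\ge 1$, $f\ge 0$ and $n>(d+2)f$ be integers and let $\varepsilon>0$. Consider $n$ agents with inputs $x_i\in\mathbb{R}^d$ (Euclidean norm) that communicate by asynchronous message passing over reliable authenticated channels (every message between correct agents is eventually received; delays are unbounded); an unknown set of at most $f$ agents is Byzantine and can send arbitrary messages. Let $\Delta$ be the diameter of the set of inputs of the correct agents, which is not known to the agents. For a multiset $V$ of vectors, each tagged with the agent it is attributed to, the safe area $S(V)$ is the intersection of the convex hulls of all sub-multisets of $V$ of size $|V|-f$. Consider the following algorithm, built on Bracha's reliable broadcast. In every round $t=0,1,2,\dots$ each agent $i$ reliably broadcasts its current vector $y_i(t)$, where $y_i(0)=x_i$; after delivering vectors of round $t$ from at least $n-f$ agents it reliably broadcasts a report, the set of these agents; agent $j$ is a witness for $i$ when $i$ has delivered a report of $j$ that lists at least $n-f$ agents, together with the vectors of all of the agents listed; when $i$ has at least $n-f$ witnesses it finishes the round. For a nonempty compact set $S$ let $m(S)$ be the midpoint of two points of $S$ that realize the Euclidean diameter of $S$, chosen by a fixed rule common to all agents. * Initial round $t=0$ (estimation): for each of its witnesses $j$, agent $i$ computes $u_j=m(S(X_j))$,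 where $X_j$ is the multiset of the vectors of round $0$ listed in the report of $j$. With $U_i$ the multiset of these $u_j$, it sets $y_i(1)=m(S(U_i))$ and $e_i=\operatorname{diam}(U_i)$. * Rounds $t\ge 1$: with $V_i(t)$ the multiset of all vectors of round $t$ that it has delivered, agent $i$ sets $y_i(t+1)=m(S(V_i(t)))$. * Agent $i$ decides $y_i(1+R_i)$, where $R_i=\lceil\log_{\sqrt{8/7}}(e_i/\varepsilon)\rceil$ if $e_i>\varepsilon$ and $R_i=0$ otherwise. It continues to take part in all rounds. Then this algorithm solves approximate consensus: in every execution each correct agent decides, irrevocably; any two decisions of correct agents have distance at most $\varepsilon$; and decisions of correct agents lie in the convex hull of the inputs of the correct agents. Moreover, in every execution the correct agents reach all rounds, and with $\delta(t)=\max_{i,j\text{ correct}}\lVert y_i(t)-y_j(t)\rVert$ and $T=\lceil\log_{\sqrt{8/7}}(\Delta/\varepsilon)\rceil$ if $\Delta>\varepsilon$, $T=0$ otherwise: 1. for all $t\ge1$ and all correct $i,j$: vectors in $V_i(t)$ attributed to a correct agent $o$ equal $y_o(t)$, $|V_i(t)\cap V_j(t)|\ge n-f$, $S(V_i(t))$ is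 contained in the convex hull of $\{y_o(t) : o \text{ correct}\}$, $S(V_i(t))\cap S(V_j(t))\ne\emptyset$, and $y_i(t+1)$ is the midpoint of two points of $S(V_i(t))$ that realize its diameter; 2. $\delta(1)\le\delta(0)=\Delta$, and $\delta(t+1)\le\sqrt{7/8}\;\delta(t)$ for all $t\ge 1$; 3. $\delta(t)\le\varepsilon$ for all $t\ge 1+T$, and every correct agent $i$ decides $y_i(r)$ for some $r$ with $1\le r\le 1+T$; that is, the round complexity is $O(\log(\Delta/\varepsilon))$, independently of $d$, $n$ and $f$. In contrast, consider the coordinate-wise (Mendes–Herlihy) algorithm with the same round structure, in which, for a given bound $D\ge\Delta$ on the initial diameter, the coordinates $k=1,\dots,d$ are treated one after the other for $\lceil\log_2(\sqrt d D/\varepsilon)\rceil$ rounds each (after the initial round), the new vector being a point of the safe area whose $k$-th coordinate is the midpoint of the set of $k$-th coordinates of the safe area, and agents decide after the last of these rounds. If $\Delta\ge\varepsilon$, then in every execution each correct agent decides, and not before it has reached round $\frac12\, d\log_2(d\Delta/\varepsilon)$; so the round complexity is $\Omega(d\log(d\Delta/\varepsilon))$. -/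

import Mathlib

noncomputable section

open scoped Classical

namespace ByzMP

/-! ### Asynchronous message passing with Byzantine agents -/

/-- A deterministic message-passing protocol for `n` agents.  Communication is by broadcast: a
message that enters the `outbox` is sent to every agent, including the sender.  `recv st s m` is the
state after receiving `m` from `s` (channels are authenticated: the receiver knows the sender). -/
structure Protocol (n : ℕ) (In Msg St Out : Type) where
  init : In → St
  recv : St → Fin n → Msg → St
  /-- all messages broadcast so far -/
  outbox : St → Set Msg
  outbox_mono : ∀ st s m, outbox st ⊆ outbox (recv st s m)
  /-- the write-once decision variable; `none` stands for `⊥` -/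
  decision : St → Option Out

/-- A schedule says which message is received at each step: `some (s, r, m)` means that `r`
receives `m` from `s`; `none` is an idle step. -/
abbrev Schedule (n : ℕ) (Msg : Type) := ℕ → Option (Fin n × Fin n × Msg)

/-- The local states after the first `k` steps. -/
def Protocol.state {n : ℕ} {In Msg St Out : Type} (P : Protocol n In Msg St Out)
    (x : Fin n → In) (ev : Schedule n Msg) : ℕ → Fin n → St
  | 0 => fun i => P.init (x i)
  | k + 1 =>
    match ev k with
    | none => P.state x ev k
    | some (s, r, m) => Function.update (P.state x ev k) r (P.recv (P.state x ev k r) s m)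

/-- Admissible asynchronous executions with set `B` of Byzantine agents.  A message received from a
correct agent was sent by it before, and a message between correct agents is eventually received;
delays are unbounded, messages can be reordered and even duplicated.  A Byzantine agent can send
any message to any agent at any time. -/
structure Protocol.IsExecution {n : ℕ} {In Msg St Out : Type} (P : Protocol n In Msg St Out)
    (B : Finset (Fin n)) (x : Fin n → In) (ev : Schedule n Msg) : Prop where
  integrity : ∀ k s r m, ev k = some (s, r, m) → s ∉ B → m ∈ P.outbox (P.state x ev k s)
  reliability : ∀ k s r m, s ∉ B → r ∉ B → m ∈ P.outbox (P.state x ev k s) →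
    ∃ k', ev k' = some (s, r, m)

/-- `P` solves approximate consensus with tolerance `ε` in the presence of up to `f` Byzantine
agents. -/
def Protocol.SolvesApproxConsensus {n : ℕ} {E Msg St : Type} [NormedAddCommGroup E]
    [NormedSpace ℝ E] (P : Protocol n E Msg St E) (f : ℕ) (ε : ℝ) : Prop :=
  ∀ B : Finset (Fin n), B.card ≤ f → ∀ (x : Fin n → E) (ev : Schedule n Msg),
    P.IsExecution B x ev →
      -- each correct agent decides
      (∀ i ∉ B, ∃ k v, P.decision (P.state x ev k i) = some v) ∧
      -- decisions are irrevocable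
      (∀ i ∉ B, ∀ k l v, k ≤ l → P.decision (P.state x ev k i) = some v →
        P.decision (P.state x ev l i) = some v) ∧
      -- ε-agreement
      (∀ i ∉ B, ∀ j ∉ B, ∀ k l v w, P.decision (P.state x ev k i) = some v →
        P.decision (P.state x ev l j) = some w → ‖v - w‖ ≤ ε) ∧
      -- validity: decisions lie in the convex hull of the inputs of the correct agents
      (∀ i ∉ B, ∀ k v, P.decision (P.state x ev k i) = some v →
        v ∈ convexHull ℝ (x '' {j | j ∉ B}))

/-! ### Safe areas -/

abbrev Vec (d : ℕ) := EuclideanSpace ℝ (Fin d)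

/-- A multiset of vectors, at most one from each agent, tagged with the agent. -/
abbrev Coll (n d : ℕ) := Fin n → Option (Vec d)

def Coll.dom {n d : ℕ} (V : Coll n d) : Finset (Fin n) :=
  Finset.univ.filter fun o => (V o).isSome

/-- The vectors that the agents in `T` contributed to `V`. -/
def Coll.vals {n d : ℕ} (V : Coll n d) (T : Finset (Fin n)) : Set (Vec d) :=
  {v | ∃ o ∈ T, V o = some v}

def Coll.restrict {n d : ℕ} (V : Coll n d) (A : Finset (Fin n)) : Coll n d :=
  fun o => if o ∈ A then V o else none

/-- The agents that contributed the same vector to `V` and to `W`, i.e. the intersection of the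
two tagged multisets. -/
def Coll.common {n d : ℕ} (V W : Coll n d) : Finset (Fin n) :=
  Finset.univ.filter fun o => ∃ v, V o = some v ∧ W o = some v

/-- The intersection of the convex hulls of all sub-multisets of `V` of size `|V| - f`. -/
def safeArea {n d : ℕ} (f : ℕ) (V : Coll n d) : Set (Vec d) :=
  {p | ∀ T ⊆ V.dom, T.card = V.dom.card - f → p ∈ convexHull ℝ (V.vals T)}

/-! ### The round structure: reliable broadcast and the witness technique -/

/-- What is reliably broadcast in round `t`: the vector of an agent, and its report, the set of
agents whose round-`t` vectors it had delivered. -/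
inductive Item (n d : ℕ) : Type
  | value (t : ℕ) (v : Vec d)
  | report (t : ℕ) (A : Finset (Fin n))

/-- Each agent has one reliable broadcast for each key. -/
def Item.key {n d : ℕ} : Item n d → ℕ × Bool
  | .value t _ => (t, false)
  | .report t _ => (t, true)

/-- Messages of Bracha's reliable broadcast; `o` is the agent whose broadcast is relayed. -/
inductive Msg (n d : ℕ) : Type
  | init (it : Item n d)
  | echo (o : Fin n) (it : Item n d)
  | ready (o : Fin n) (it : Item n d)

/-- The parameters of the round structure that distinguish the algorithms: `point t S` is the new
vector computed in round `t` from the safe area `S`, and `rounds e` is the number of rounds after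
the initial one until the decision, where `e` is the diameter estimated in the initial round. -/
structure Rule (d : ℕ) where
  point : ℕ → Set (Vec d) → Vec d
  rounds : ℝ → ℕ

structure LocalState (n d : ℕ) where
  /-- messages received, with their senders -/
  rcv : Set (Fin n × Msg n d)
  /-- messages broadcast -/
  sent : Set (Msg n d)
  /-- current round -/
  round : ℕ
  /-- `val t` is the agent's vector at the beginning of round `t`, for `t ≤ round` -/
  val : ℕ → Vec d
  /-- `coll t` is the multiset whose safe area was used in round `t`, for `t < round` -/
  coll : ℕ → Coll n d
  /-- the estimated diameter, for `1 ≤ round` -/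
  est : ℝ

namespace LocalState

variable {n d : ℕ}

def echoes (st : LocalState n d) (o : Fin n) (it : Item n d) : ℕ :=
  (Finset.univ.filter fun j : Fin n => (j, Msg.echo o it) ∈ st.rcv).card

def readies (st : LocalState n d) (o : Fin n) (it : Item n d) : ℕ :=
  (Finset.univ.filter fun j : Fin n => (j, Msg.ready o it) ∈ st.rcv).card

/-- `it` has been delivered by the reliable broadcast of `o`. -/
def Delivered (f : ℕ) (st : LocalState n d) (o : Fin n) (it : Item n d) : Prop :=
  2 * f + 1 ≤ st.readies o it

/-- The vectors of round `t` delivered so far. -/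
def values (f : ℕ) (st : LocalState n d) (t : ℕ) : Coll n d := fun o =>
  if h : ∃ v, st.Delivered f o (.value t v) then some h.choose else none

/-- The report of `j` for round `t`, provided that it is valid: it lists at least `n - f` agents, and
the vectors of all of them have been delivered. -/
def reportOf (f : ℕ) (st : LocalState n d) (t : ℕ) (j : Fin n) : Option (Finset (Fin n)) :=
  if h : ∃ A : Finset (Fin n), st.Delivered f j (.report t A) ∧ n - f ≤ A.card ∧
      A ⊆ (st.values f t).dom
  then some h.choose else none

/-- The witnesses for round `t`: the agents with a valid report. -/
def witnesses (f : ℕ) (st : LocalState n d) (t : ℕ) : Finset (Fin n) :=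
  Finset.univ.filter fun j => (st.reportOf f t j).isSome

/-- Bracha's reliable broadcast: reaction to the reception of `m` from `s`, where `m` is already
recorded in `rcv`. -/
def relay (f : ℕ) (st : LocalState n d) (s : Fin n) : Msg n d → LocalState n d
  | .init it =>
    if ∀ it' : Item n d, it'.key = it.key → Msg.echo s it' ∉ st.sent
    then { st with sent := insert (Msg.echo s it) st.sent } else st
  | .echo o it =>
    if n - f ≤ st.echoes o it ∧
      ∀ it' : Item n d, it'.key = it.key → Msg.ready o it' ∉ st.sent
    then { st with sent := insert (Msg.ready o it) st.sent } else st
  | .ready o it =>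
    if f + 1 ≤ st.readies o it ∧
      ∀ it' : Item n d, it'.key = it.key → Msg.ready o it' ∉ st.sent
    then { st with sent := insert (Msg.ready o it) st.sent } else st

/-- The multiset used in the current round.  In rounds `t ≥ 1` these are all vectors of the round
delivered so far.  In the initial round `0` each witness contributes the point that the rule selects
in the safe area of the vectors listed in its report; these points, unlike the delivered vectors,
lie in the convex hull of the inputs of the correct agents even for Byzantine witnesses. -/
def current (f : ℕ) (R : Rule d) (st : LocalState n d) : Coll n d :=
  if st.round = 0 then fun j => (st.reportOf f 0 j).map fun A =>
      R.point 0 (safeArea f ((st.values f 0).restrict A))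
  else st.values f st.round

/-- Go to the next round: update the vector inside the safe area and broadcast it.  The initial
round also yields the estimate of the diameter. -/
def advance (f : ℕ) (R : Rule d) (st : LocalState n d) : LocalState n d :=
  let V := st.current f R
  let y := R.point st.round (safeArea f V)
  { st with
    sent := insert (Msg.init (.value (st.round + 1) y)) st.sent
    round := st.round + 1
    val := Function.update st.val (st.round + 1) y
    coll := Function.update st.coll st.round V
    est := if st.round = 0 then Metric.diam (V.vals V.dom) else st.est }

/-- The agent has broadcast its report for the current round. -/
def Reported (st : LocalState n d) : Prop :=
  ∃ A, Msg.init (.report st.round A) ∈ st.sent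

/-- After `n - f` vectors of the current round have been delivered, broadcast a report; after that,
when there are `n - f` witnesses, go to the next round. -/
def progress (f : ℕ) (R : Rule d) (st : LocalState n d) : LocalState n d :=
  if st.Reported then
    if n - f ≤ (st.witnesses f st.round).card then st.advance f R else st
  else if n - f ≤ (st.values f st.round).dom.card then
    { st with sent :=
        insert (Msg.init (.report st.round (st.values f st.round).dom)) st.sent }
  else st

def receive (f : ℕ) (R : Rule d) (st : LocalState n d) (s : Fin n) (m : Msg n d) :
    LocalState n d :=
  (relay f { st with rcv := insert (s, m) st.rcv } s m).progress f R

theorem subset_relay (f : ℕ) (st : LocalState n d) (s : Fin n) (m : Msg n d) :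
    st.sent ⊆ (st.relay f s m).sent := by
  cases m <;> simp only [relay] <;> split_ifs <;>
    first | exact Set.subset_insert _ _ | exact subset_rfl

theorem subset_progress (f : ℕ) (R : Rule d) (st : LocalState n d) :
    st.sent ⊆ (st.progress f R).sent := by
  unfold progress advance
  split_ifs <;> first | exact Set.subset_insert _ _ | exact subset_rfl

end LocalState

/-- The round structure: an agent starts in the initial round `0` with its input, runs forever, and
decides the vector it has after the initial round and `R.rounds e` further rounds, where `e` is its
estimate of the diameter. -/
def roundProtocol (n d f : ℕ) (R : Rule d) :
    Protocol n (Vec d) (Msg n d) (LocalState n d) (Vec d) where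
  init x :=
    { rcv := ∅, sent := {Msg.init (.value 0 x)}, round := 0, val := fun _ => x,
      coll := fun _ _ => none, est := 0 }
  recv st s m := st.receive f R s m
  outbox st := st.sent
  outbox_mono st s m :=
    (LocalState.subset_relay f { st with rcv := insert (s, m) st.rcv } s m).trans
      (LocalState.subset_progress f R _)
  decision st :=
    if 1 + R.rounds st.est ≤ st.round then some (st.val (1 + R.rounds st.est)) else none

/-! ### The two algorithms -/

/-- `sel` selects two points that realize the diameter. -/
def IsDiamSelector {d : ℕ} (sel : Set (Vec d) → Vec d × Vec d) : Prop :=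
  ∀ S, IsCompact S → S.Nonempty →
    (sel S).1 ∈ S ∧ (sel S).2 ∈ S ∧ dist (sel S).1 (sel S).2 = Metric.diam S

/-- Number of rounds after which a diameter of at most `D` has shrunk to at most `ε`, at the rate
`√(7/8)` per round. -/
def midRounds (ε D : ℝ) : ℕ := ⌈Real.logb (Real.sqrt (8 / 7)) (D / ε)⌉₊

/-- The new vector is the midpoint of two points that realize the diameter of the safe area. -/
def midExtremes {d : ℕ} (sel : Set (Vec d) → Vec d × Vec d) (ε : ℝ) : Rule d where
  point _ S := midpoint ℝ (sel S).1 (sel S).2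
  rounds e := midRounds ε e

/-- `c k` selects a point whose `k`-th coordinate is the midpoint of the set of `k`-th coordinates. -/
def IsCoordSelector {d : ℕ} (c : ℕ → Set (Vec d) → Vec d) : Prop :=
  ∀ (k : Fin d) (S : Set (Vec d)), IsCompact S → Convex ℝ S → S.Nonempty →
    c k S ∈ S ∧ c k S k = (sInf ((fun p : Vec d => p k) '' S) + sSup ((fun p : Vec d => p k) '' S)) / 2

/-- Number of rounds per coordinate in the coordinate-wise algorithm: after halving that often, a
diameter of at most `D` has shrunk to at most `ε / √d`. -/
def coordRounds (d : ℕ) (ε D : ℝ) : ℕ := ⌈Real.logb 2 (Real.sqrt d * D / ε)⌉₊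

/-- The coordinate-wise Mendes–Herlihy algorithm for a bound `D` on the diameter: the coordinates
are treated one after the other, for `coordRounds d ε D` rounds each. -/
def mendesHerlihy {d : ℕ} (c : ℕ → Set (Vec d) → Vec d) (ε D : ℝ) : Rule d where
  point t S := c ((t - 1) / coordRounds d ε D % d) S
  rounds _ := d * coordRounds d ε D

/-- The diameter of the vectors of the correct agents. -/
def correctDiam {n d : ℕ} (B : Finset (Fin n)) (y : Fin n → Vec d) : ℝ :=
  Metric.diam (y '' {i | i ∉ B})

end ByzMP

end

open ByzMP

noncomputable section

open scoped Classical

namespace ByzMP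

/-! ### Geometry of safe areas -/

namespace Coll

variable {n d : ℕ}

/-! Communication. Since `n > 3f`, two echo quorums of size `n - f` share more than `f` agents,
hence a correct one. So correct agents never deliver different items for one broadcast
(`delivered_agreement`), and what one of them delivers, all eventually deliver. Two correct agents
also share a witness, possibly Byzantine; as its report is the same for both, their multisets of a
round `t ≥ 1` agree on `n - f` entries. `exists_isTrace` extracts these facts, and the later
arguments hardly mention messages.

Geometry. Any `d + 1` sub-multisets together omit at most `(d + 1) f < n - f` entries, so Helly's
theorem makes safe areas nonempty, and the safe area of the common entries lies in both safe areas.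
Let `p`, `q` be the diameters of two safe areas, `m`, `m'` the midpoints of their diameters, `c` a
common point and `δ` the diameter of the correct vectors. Apollonius' identity gives `|mm'|² ≤ δ² -
(p² + q²)/4`, and also `|cm|² ≤ 3p²/4` and `|cm'|² ≤ 3q²/4`, so `|mm'|² ≤ 3(p² + q²)/2`. Together
`|mm'|² ≤ (6/7) δ²`, which is within the claimed `7/8` (`dist_midpoint_le`).

Stopping. The points exchanged in the initial round lie in the hull of the correct inputs, so no
estimate exceeds `Δ`. Conversely, all correct vectors of round 1 lie in the hull of the points that
any single correct agent saw, so every estimate bounds `δ(1)`. Whoever stops first is thus already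
in an `ε`-small hull, and the hulls are nested, so later deciders stay in it.

Lower bound. The coordinate-wise algorithm decides after a fixed number of rounds, and only that
number has to be estimated. -/

theorem mem_dom {V : Coll n d} {o : Fin n} : o ∈ V.dom ↔ ∃ v, V o = some v := by
  simp [dom, Option.isSome_iff_exists]

theorem finite_vals (V : Coll n d) (T : Finset (Fin n)) : (V.vals T).Finite := by
  refine (T.finite_toSet.image fun o => (V o).getD 0).subset ?_
  rintro v ⟨o, ho, hv⟩
  exact ⟨o, ho, by simp [hv]⟩

theorem vals_mono (V : Coll n d) {T T' : Finset (Fin n)} (h : T ⊆ T') : V.vals T ⊆ V.vals T' :=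
  fun _ ⟨o, ho, hv⟩ => ⟨o, h ho, hv⟩

theorem mem_common {V W : Coll n d} {o : Fin n} :
    o ∈ V.common W ↔ ∃ v, V o = some v ∧ W o = some v := by
  simp [common]

theorem common_subset_dom (V W : Coll n d) : V.common W ⊆ V.dom := fun _ ho =>
  let ⟨v, hv, _⟩ := mem_common.1 ho
  mem_dom.2 ⟨v, hv⟩

theorem common_comm (V W : Coll n d) : V.common W = W.common V := by
  ext o; simp [mem_common, and_comm]

theorem restrict_common (V W : Coll n d) :
    V.restrict (V.common W) = W.restrict (V.common W) := by
  funext o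
  by_cases ho : o ∈ V.common W
  · obtain ⟨v, h1, h2⟩ := mem_common.1 ho
    simp [restrict, ho, h1, h2]
  · simp [restrict, ho]

theorem dom_restrict (V : Coll n d) {A : Finset (Fin n)} (h : A ⊆ V.dom) :
    (V.restrict A).dom = A := by
  ext o
  by_cases ho : o ∈ A
  · simpa [mem_dom, restrict, ho] using mem_dom.1 (h ho)
  · simp [mem_dom, restrict, ho]

end Coll

section Geometry

variable {n d f : ℕ}

theorem convex_safeArea (V : Coll n d) : Convex ℝ (safeArea f V) := by
  have : safeArea f V = ⋂ T : Finset (Fin n), ⋂ (_ : T ⊆ V.dom),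
      ⋂ (_ : T.card = V.dom.card - f), convexHull ℝ (V.vals T) := by
    ext p; simp [safeArea]
  rw [this]
  exact convex_iInter fun T => convex_iInter fun _ => convex_iInter fun _ => convex_convexHull ℝ _

/-- The definition only mentions sub-multisets of size exactly `|V| - f`, but every larger one
contains one of these. -/
theorem safeArea_subset_convexHull {V : Coll n d} {T : Finset (Fin n)} (hT : T ⊆ V.dom)
    (hc : V.dom.card ≤ T.card + f) : safeArea f V ⊆ convexHull ℝ (V.vals T) := by
  obtain ⟨T', hT', hc'⟩ := Finset.exists_subset_card_eq
    (show V.dom.card - f ≤ T.card by omega)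
  exact fun p hp => convexHull_mono (V.vals_mono hT') (hp T' (hT'.trans hT) hc')

theorem isCompact_safeArea (V : Coll n d) : IsCompact (safeArea f V) := by
  have hcl : IsClosed (safeArea f V) := by
    have : safeArea f V = ⋂ T : Finset (Fin n), ⋂ (_ : T ⊆ V.dom),
        ⋂ (_ : T.card = V.dom.card - f), convexHull ℝ (V.vals T) := by
      ext p; simp [safeArea]
    rw [this]
    exact isClosed_iInter fun T => isClosed_iInter fun _ => isClosed_iInter fun _ =>
      ((V.finite_vals T).isCompact_convexHull ℝ).isClosed
  exact ((V.finite_vals V.dom).isCompact_convexHull ℝ).of_isClosed_subset hcl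
    (safeArea_subset_convexHull subset_rfl (by omega))

/-- A sub-multiset that omits at most `f` entries of `V` also omits at most `f` of those in `A`. -/
theorem safeArea_restrict_subset (V : Coll n d) {A : Finset (Fin n)} (h : A ⊆ V.dom) :
    safeArea f (V.restrict A) ⊆ safeArea f V := by
  intro p hp T hT hc
  have hdom := V.dom_restrict h
  have hcard : A.card + T.card ≤ (T ∩ A).card + V.dom.card := by
    have h1 := Finset.card_union_add_card_inter T A
    have h2 := Finset.card_le_card (Finset.union_subset hT h)
    omega
  have hp' := safeArea_subset_convexHull (V := V.restrict A) (T := T ∩ A)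
    (by rw [hdom]; exact Finset.inter_subset_right) (by rw [hdom]; omega) hp
  refine convexHull_mono ?_ hp'
  rintro v ⟨o, ho, hv⟩
  rw [Finset.mem_inter] at ho
  exact ⟨o, ho.1, by simpa [Coll.restrict, ho.2] using hv⟩

/-- Helly's theorem: `d + 1` sub-multisets together omit at most `(d + 1) f < n - f ≤ |V|` entries,
so some entry belongs to all of them. -/
theorem safeArea_nonempty (hn : (d + 2) * f < n) {V : Coll n d} (hV : n - f ≤ V.dom.card) :
    (safeArea f V).Nonempty := by
  have key : (⋂ T ∈ Finset.powersetCard (V.dom.card - f) V.dom,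
      convexHull ℝ (V.vals T)).Nonempty := by
    refine Convex.helly_theorem' (𝕜 := ℝ) (fun T _ => convex_convexHull ℝ _) ?_
    intro I hI hcard
    rw [finrank_euclideanSpace_fin] at hcard
    have hb : (I.biUnion fun T => V.dom \ T).card ≤ I.card * f := by
      refine Finset.card_biUnion_le_card_mul _ _ _ fun T hT => ?_
      obtain ⟨h1, h2⟩ := Finset.mem_powersetCard.1 (hI hT)
      rw [Finset.card_sdiff_of_subset h1]
      omega
    have hlt : (I.biUnion fun T => V.dom \ T).card < V.dom.card := by
      have h3 : I.card * f ≤ (d + 1) * f := Nat.mul_le_mul_right _ hcard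
      have h4 : (d + 2) * f = (d + 1) * f + f := by ring
      omega
    obtain ⟨o, ho, hno⟩ := Finset.exists_mem_notMem_of_card_lt_card hlt
    obtain ⟨v, hv⟩ := Coll.mem_dom.1 ho
    refine ⟨v, Set.mem_iInter₂.2 fun T hT => subset_convexHull ℝ _ ⟨o, ?_, hv⟩⟩
    by_contra hoT
    exact hno (Finset.mem_biUnion.2 ⟨T, hT, Finset.mem_sdiff.2 ⟨ho, hoT⟩⟩)
  obtain ⟨p, hp⟩ := key
  exact ⟨p, fun T hT hc => Set.mem_iInter₂.1 hp T (Finset.mem_powersetCard.2 ⟨hT, hc⟩)⟩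

/-- The common entries alone are numerous enough for a nonempty safe area, which lies in both safe
areas. -/
theorem safeArea_inter_nonempty (hn : (d + 2) * f < n) {V W : Coll n d}
    (h : n - f ≤ (V.common W).card) : (safeArea f V ∩ safeArea f W).Nonempty := by
  have hV := Coll.common_subset_dom V W
  have hW : V.common W ⊆ W.dom := Coll.common_comm V W ▸ Coll.common_subset_dom W V
  obtain ⟨p, hp⟩ := safeArea_nonempty hn (V := V.restrict (V.common W))
    (by rwa [V.dom_restrict hV])
  exact ⟨p, safeArea_restrict_subset V hV hp,
    safeArea_restrict_subset W hW (V.restrict_common W ▸ hp)⟩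

/-- At most `f` of the contributions can be omitted in a safe area, so those of a set `B` of at most
`f` agents do not matter. -/
theorem safeArea_subset_of_correct {B : Finset (Fin n)} (hB : B.card ≤ f) {V : Coll n d}
    {s : Set (Vec d)} (h : ∀ o ∉ B, ∀ v, V o = some v → v ∈ s) :
    safeArea f V ⊆ convexHull ℝ s := by
  refine (safeArea_subset_convexHull (T := V.dom \ B) Finset.sdiff_subset ?_).trans
    (convexHull_mono ?_)
  · have := Finset.le_card_sdiff B V.dom
    omega
  · rintro v ⟨o, ho, hv⟩
    exact h o (Finset.mem_sdiff.1 ho).2 v hv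

/-- If the midpoints of diameters of two sets that share a point lie in a set of diameter `δ`,
then they are at distance at most `√(7/8) δ`. -/
theorem dist_midpoint_le {E : Type*} [NormedAddCommGroup E] [InnerProductSpace ℝ E]
    {S S' X : Set E} (hX : Bornology.IsBounded X) (hS : S ⊆ X) (hS' : S' ⊆ X)
    {a b a' b' c : E} (ha : a ∈ S) (hb : b ∈ S) (ha' : a' ∈ S') (hb' : b' ∈ S')
    (hab : dist a b = Metric.diam S) (hab' : dist a' b' = Metric.diam S')
    (hc : c ∈ S) (hc' : c ∈ S') :
    dist (midpoint ℝ a b) (midpoint ℝ a' b') ≤ Real.sqrt (7 / 8) * Metric.diam X := by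
  have hd {Y : Set E} (hY : Y ⊆ X) {p q : E} (hp : p ∈ Y) (hq : q ∈ Y) :
      dist p q ≤ Metric.diam Y := Metric.dist_le_diam_of_mem (hX.subset hY) hp hq
  have sq {r s : ℝ} (h0 : 0 ≤ r) (h : r ≤ s) : r ^ 2 ≤ s ^ 2 := pow_le_pow_left₀ h0 h 2
  have med := fun p q r : E =>
    EuclideanGeometry.dist_sq_add_dist_sq_eq_two_mul_dist_midpoint_sq_add_half_dist_sq p q r
  set m := midpoint ℝ a b
  set m' := midpoint ℝ a' b'
  set D := Metric.diam X
  have q1 := sq dist_nonneg (hd subset_rfl (hS ha) (hS' ha'))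
  have q2 := sq dist_nonneg (hd subset_rfl (hS ha) (hS' hb'))
  have q3 := sq dist_nonneg (hd subset_rfl (hS hb) (hS' ha'))
  have q4 := sq dist_nonneg (hd subset_rfl (hS hb) (hS' hb'))
  have e1 := med a a' b'
  have e2 := med b a' b'
  have e3 := med m' a b
  have c1 := med c a b
  have c2 := med c a' b'
  have r1 := sq dist_nonneg (hd hS hc ha)
  have r2 := sq dist_nonneg (hd hS hc hb)
  have r3 := sq dist_nonneg (hd hS' hc' ha')
  have r4 := sq dist_nonneg (hd hS' hc' hb')
  have tri := sq dist_nonneg (dist_triangle m c m')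
  rw [dist_comm m c] at tri
  rw [dist_comm m' a, dist_comm m' b, dist_comm m' m] at e3
  rw [← hab] at r1 r2
  rw [← hab'] at r3 r4
  have hD : 0 ≤ D := Metric.diam_nonneg
  refine le_of_sq_le_sq ?_ (by positivity)
  rw [mul_pow, Real.sq_sqrt (by norm_num)]
  -- `e1`–`e3` with `q1`–`q4` bound `|mm'|²` by `D²` minus a quarter of the squared diameters. `c1`,
  -- `c2` with `r1`–`r4` bound the medians from `c`, and the hint turns `tri` into `|mm'|² ≤ 2|cm|²
  -- + 2|cm'|²`.
  nlinarith [sq_nonneg (dist c m - dist c m')]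

theorem midpoint_selector_mem {sel : Set (Vec d) → Vec d × Vec d} (hsel : IsDiamSelector sel)
    {S : Set (Vec d)} (hS : IsCompact S) (hne : S.Nonempty) (hc : Convex ℝ S) :
    midpoint ℝ (sel S).1 (sel S).2 ∈ S :=
  let h := hsel S hS hne
  hc.midpoint_mem h.1 h.2.1

end Geometry

/-! ### Numbers of rounds -/

theorem one_lt_sqrt_eight_sevenths : 1 < Real.sqrt (8 / 7) := by
  rw [Real.lt_sqrt] <;> norm_num

/-- The exponent is chosen so that `D / ε ≤ √(8/7) ^ midRounds ε D`, and `√(7/8)` is the inverse of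
`√(8/7)`. For `0 ≤ D ≤ ε` the natural-number ceiling is `0`, which builds in the case distinction of
the algorithm. -/
theorem pow_midRounds_mul_le {ε D : ℝ} (hε : 0 < ε) :
    Real.sqrt (7 / 8) ^ midRounds ε D * D ≤ ε := by
  rcases le_or_gt D 0 with hD | hD
  · exact (mul_nonpos_of_nonneg_of_nonpos (by positivity) hD).trans hε.le
  have h1 : D / ε ≤ Real.sqrt (8 / 7) ^ midRounds ε D := by
    have := Nat.le_ceil (Real.logb (Real.sqrt (8 / 7)) (D / ε))
    rw [Real.logb_le_iff_le_rpow one_lt_sqrt_eight_sevenths (by positivity),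
      Real.rpow_natCast] at this
    exact this
  have h2 : Real.sqrt (7 / 8) * Real.sqrt (8 / 7) = 1 := by
    rw [← Real.sqrt_mul (by norm_num)]; norm_num
  rw [div_le_iff₀ hε] at h1
  calc Real.sqrt (7 / 8) ^ midRounds ε D * D
      ≤ Real.sqrt (7 / 8) ^ midRounds ε D * (Real.sqrt (8 / 7) ^ midRounds ε D * ε) := by gcongr
    _ = ε := by rw [← mul_assoc, ← mul_pow, h2, one_pow, one_mul]

theorem midRounds_mono {ε D D' : ℝ} (hε : 0 < ε) (hD : 0 ≤ D) (h : D ≤ D') :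
    midRounds ε D ≤ midRounds ε D' := by
  -- For `D = 0` the convention `logb b 0 = 0` yields no rounds.
  rcases hD.eq_or_lt with rfl | hD
  · simp [midRounds]
  · exact Nat.ceil_mono (Real.logb_le_logb_of_le one_lt_sqrt_eight_sevenths (by positivity)
      (by gcongr))

/-- `log (√d Δ/ε) = ½ log d + log (Δ/ε)`, and the last term is nonnegative because `ε ≤ Δ`; so half
of `log (dΔ/ε)` is a lower bound. -/
theorem half_mul_logb_le_coordRounds {d : ℕ} (hd : 1 ≤ d) {ε Δ D : ℝ} (hε : 0 < ε) (h : ε ≤ Δ)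
    (hD : Δ ≤ D) :
    1 / 2 * (d * Real.logb 2 (d * Δ / ε)) ≤ (d * coordRounds d ε D : ℕ) := by
  have hd' : (0 : ℝ) < d := by exact_mod_cast hd
  have hΔ : 0 < Δ := hε.trans_le h
  have h1 : Real.logb 2 (Real.sqrt d * D / ε) ≤ coordRounds d ε D := Nat.le_ceil _
  have h2 : Real.logb 2 (Real.sqrt d * Δ / ε) ≤ Real.logb 2 (Real.sqrt d * D / ε) :=
    Real.logb_le_logb_of_le (by norm_num) (by positivity) (by gcongr)
  have h3 : Real.logb 2 (d * Δ / ε) = Real.logb 2 d + Real.logb 2 (Δ / ε) := by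
    rw [mul_div_assoc, Real.logb_mul hd'.ne' (by positivity)]
  have h4 : Real.logb 2 (Real.sqrt d * Δ / ε) = 1 / 2 * Real.logb 2 d + Real.logb 2 (Δ / ε) := by
    rw [mul_div_assoc, Real.logb_mul (by positivity) (by positivity), Real.sqrt_eq_rpow,
      Real.logb_rpow_eq_mul_logb_of_pos hd']
  have h5 : 0 ≤ Real.logb 2 (Δ / ε) :=
    Real.logb_nonneg (by norm_num) ((one_le_div hε).2 h)
  push_cast
  nlinarith

/-! ### Local invariants of the round structure -/

namespace LocalState

variable {n d f : ℕ} {R : Rule d} {st st' : LocalState n d} {s o : Fin n} {m : Msg n d}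

/-- Bracha's reliable broadcast, including the recording of the message. -/
def relayed (f : ℕ) (st : LocalState n d) (s : Fin n) (m : Msg n d) : LocalState n d :=
  relay f { st with rcv := insert (s, m) st.rcv } s m

theorem receive_eq : st.receive f R s m = (st.relayed f s m).progress f R := rfl

theorem relay_eq : st.relay f s m = { st with sent := (st.relay f s m).sent } := by
  cases m <;> simp only [relay] <;> split_ifs <;> rfl

theorem relayed_eq : st.relayed f s m =
    { st with rcv := insert (s, m) st.rcv, sent := (st.relayed f s m).sent } := relay_eq

theorem rcv_relayed : (st.relayed f s m).rcv = insert (s, m) st.rcv := by rw [relayed_eq]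

theorem round_relayed : (st.relayed f s m).round = st.round := by rw [relayed_eq]

theorem val_relayed : (st.relayed f s m).val = st.val := by rw [relayed_eq]

theorem coll_relayed : (st.relayed f s m).coll = st.coll := by rw [relayed_eq]

theorem est_relayed : (st.relayed f s m).est = st.est := by rw [relayed_eq]

theorem sent_subset_relayed : st.sent ⊆ (st.relayed f s m).sent :=
  subset_relay f { st with rcv := insert (s, m) st.rcv } s m

theorem init_mem_sent_relayed {it : Item n d} :
    Msg.init it ∈ (st.relayed f s m).sent ↔ Msg.init it ∈ st.sent := by
  unfold relayed
  cases m <;> simp only [relay] <;> split_ifs <;> simp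

theorem rcv_progress : (st.progress f R).rcv = st.rcv := by
  unfold progress advance
  split_ifs <;> rfl

theorem echo_mem_sent_progress {it : Item n d} :
    Msg.echo o it ∈ (st.progress f R).sent ↔ Msg.echo o it ∈ st.sent := by
  unfold progress advance
  split_ifs <;> simp

theorem ready_mem_sent_progress {it : Item n d} :
    Msg.ready o it ∈ (st.progress f R).sent ↔ Msg.ready o it ∈ st.sent := by
  unfold progress advance
  split_ifs <;> simp

theorem rcv_receive : (st.receive f R s m).rcv = insert (s, m) st.rcv := by
  rw [receive_eq, rcv_progress, rcv_relayed]

/-! #### Monotonicity -/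

/-- `st'` arises from `st` without changing what has been recorded. -/
structure Extends (st st' : LocalState n d) : Prop where
  rcv : st.rcv ⊆ st'.rcv
  sent : st.sent ⊆ st'.sent
  round : st.round ≤ st'.round
  val : ∀ t ≤ st.round, st'.val t = st.val t
  coll : ∀ t < st.round, st'.coll t = st.coll t
  est : 0 < st.round → st'.est = st.est

theorem Extends.refl (st : LocalState n d) : Extends st st :=
  ⟨subset_rfl, subset_rfl, le_rfl, fun _ _ => rfl, fun _ _ => rfl, fun _ => rfl⟩

theorem Extends.trans {st₁ st₂ st₃ : LocalState n d} (h : Extends st₁ st₂) (h' : Extends st₂ st₃) :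
    Extends st₁ st₃ where
  rcv := h.rcv.trans h'.rcv
  sent := h.sent.trans h'.sent
  round := h.round.trans h'.round
  val t ht := (h'.val t (ht.trans h.round)).trans (h.val t ht)
  coll t ht := (h'.coll t (ht.trans_le h.round)).trans (h.coll t ht)
  est ht := (h'.est (ht.trans_le h.round)).trans (h.est ht)

theorem extends_relayed : Extends st (st.relayed f s m) where
  rcv := by rw [rcv_relayed]; exact Set.subset_insert _ _
  sent := sent_subset_relayed
  round := round_relayed.ge
  val _ _ := by rw [val_relayed]
  coll _ _ := by rw [coll_relayed]
  est _ := est_relayed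

theorem extends_advance : Extends st (st.advance f R) where
  rcv := subset_rfl
  sent := Set.subset_insert _ _
  round := Nat.le_succ _
  val t ht := Function.update_of_ne (by omega) _ _
  coll t ht := Function.update_of_ne (by omega) _ _
  est ht := by simp [advance, ht.ne']

theorem extends_progress : Extends st (st.progress f R) := by
  unfold progress
  split_ifs
  · exact extends_advance
  · exact Extends.refl _
  · exact { Extends.refl st with sent := Set.subset_insert _ _ }
  · exact Extends.refl _

theorem extends_receive : Extends st (st.receive f R s m) :=
  extends_relayed.trans extends_progress

theorem readies_mono (h : st.rcv ⊆ st'.rcv) (o : Fin n) (it : Item n d) :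
    st.readies o it ≤ st'.readies o it :=
  Finset.card_le_card fun _ hj => by
    simp only [Finset.mem_filter, Finset.mem_univ, true_and] at hj ⊢
    exact h hj

theorem echoes_mono (h : st.rcv ⊆ st'.rcv) (o : Fin n) (it : Item n d) :
    st.echoes o it ≤ st'.echoes o it :=
  Finset.card_le_card fun _ hj => by
    simp only [Finset.mem_filter, Finset.mem_univ, true_and] at hj ⊢
    exact h hj

theorem Delivered.mono {it : Item n d} (hd : st.Delivered f o it) (h : st.rcv ⊆ st'.rcv) :
    st'.Delivered f o it :=
  le_trans hd (readies_mono h o it)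

/-! #### Delivered vectors and reports -/

theorem delivered_of_values {t : ℕ} {v : Vec d} (h : st.values f t o = some v) :
    st.Delivered f o (.value t v) := by
  unfold values at h
  split_ifs at h with h'
  rw [← Option.some.inj h]
  exact h'.choose_spec

theorem mem_dom_values {t : ℕ} :
    o ∈ (st.values f t).dom ↔ ∃ v, st.Delivered f o (.value t v) := by
  rw [Coll.mem_dom]
  refine ⟨fun ⟨v, hv⟩ => ⟨v, delivered_of_values hv⟩, fun h => ?_⟩
  exact ⟨_, dif_pos h⟩

theorem reportOf_eq_some {t : ℕ} {A : Finset (Fin n)} (h : st.reportOf f t o = some A) :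
    st.Delivered f o (.report t A) ∧ n - f ≤ A.card ∧ A ⊆ (st.values f t).dom := by
  unfold reportOf at h
  split_ifs at h with h'
  rw [← Option.some.inj h]
  exact h'.choose_spec

theorem mem_witnesses {t : ℕ} : o ∈ st.witnesses f t ↔ ∃ A : Finset (Fin n),
    st.Delivered f o (.report t A) ∧ n - f ≤ A.card ∧ A ⊆ (st.values f t).dom := by
  unfold witnesses
  rw [Finset.mem_filter]
  refine ⟨fun h => ?_, fun h => ⟨Finset.mem_univ _, ?_⟩⟩
  · obtain ⟨A, hA⟩ := Option.isSome_iff_exists.1 h.2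
    exact ⟨A, reportOf_eq_some hA⟩
  · unfold reportOf
    rw [dif_pos h]
    rfl

/-! #### Invariants of the reliable broadcast -/

/-- The last three clauses promise only a message with the same key, since a conflicting item may
have been served earlier; equality of the items follows from global agreement. In `ready_of_echoes`,
`1 ≤ st.echoes o it` excludes the degenerate case `n ≤ f`, where the threshold is met before any
echo arrives. -/
structure BroadcastInv (f : ℕ) (st : LocalState n d) : Prop where
  echo_unique : ∀ o (it it' : Item n d), it.key = it'.key → Msg.echo o it ∈ st.sent →
    Msg.echo o it' ∈ st.sent → it = it'
  init_of_echo : ∀ o (it : Item n d), Msg.echo o it ∈ st.sent → (o, Msg.init it) ∈ st.rcv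
  quorum_of_ready : ∀ o (it : Item n d), Msg.ready o it ∈ st.sent →
    n - f ≤ st.echoes o it ∨ f + 1 ≤ st.readies o it
  echo_of_init : ∀ o (it : Item n d), (o, Msg.init it) ∈ st.rcv →
    ∃ it' : Item n d, it'.key = it.key ∧ Msg.echo o it' ∈ st.sent
  ready_of_echoes : ∀ o (it : Item n d), 1 ≤ st.echoes o it → n - f ≤ st.echoes o it →
    ∃ it' : Item n d, it'.key = it.key ∧ Msg.ready o it' ∈ st.sent
  ready_of_readies : ∀ o (it : Item n d), f + 1 ≤ st.readies o it →
    ∃ it' : Item n d, it'.key = it.key ∧ Msg.ready o it' ∈ st.sent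

theorem BroadcastInv.congr (h : BroadcastInv f st) (hr : st'.rcv = st.rcv)
    (he : ∀ o it, Msg.echo o it ∈ st'.sent ↔ Msg.echo o it ∈ st.sent)
    (hy : ∀ o it, Msg.ready o it ∈ st'.sent ↔ Msg.ready o it ∈ st.sent) : BroadcastInv f st' := by
  obtain ⟨h1, h2, h3, h4, h5, h6⟩ := h
  constructor
  all_goals
    simp only [he, hy, hr, echoes, readies] at *
    assumption

theorem BroadcastInv.progress (h : BroadcastInv f st) : BroadcastInv f (st.progress f R) :=
  h.congr rcv_progress (fun _ _ => echo_mem_sent_progress) fun _ _ => ready_mem_sent_progress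

theorem BroadcastInv.receive_init (h : BroadcastInv f st) (s : Fin n) (it : Item n d) :
    BroadcastInv f (st.relayed f s (.init it)) := by
  have hsub : st.rcv ⊆ (st.relayed f s (.init it)).rcv := extends_relayed.rcv
  have hre : ∀ o it', Msg.ready o it' ∈ (st.relayed f s (.init it)).sent ↔
      Msg.ready o it' ∈ st.sent := by
    intro o it'
    simp only [relayed, relay]; split_ifs <;> simp
  have hec : ∀ o it', (st.relayed f s (.init it)).echoes o it' = st.echoes o it' := by
    intro o it'; simp [echoes, rcv_relayed]
  have hrd : ∀ o it', (st.relayed f s (.init it)).readies o it' = st.readies o it' := by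
    intro o it'; simp [readies, rcv_relayed]
  have hes : ∀ o it', Msg.echo o it' ∈ (st.relayed f s (.init it)).sent ↔
      Msg.echo o it' ∈ st.sent ∨ (o = s ∧ it' = it ∧
        ∀ it' : Item n d, it'.key = it.key → Msg.echo s it' ∉ st.sent) := by
    intro o it'
    simp only [relayed, relay]
    split_ifs with hc
    · simp only [Set.mem_insert_iff, Msg.echo.injEq]; tauto
    · tauto
  constructor
  · intro o a b hab ha hb
    rw [hes] at ha hb
    rcases ha with ha | ⟨rfl, rfl, ha⟩ <;> rcases hb with hb | ⟨h1, rfl, hb⟩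
    · exact h.echo_unique o a b hab ha hb
    · subst h1; exact absurd ha (hb a hab)
    · exact absurd hb (ha b hab.symm)
    · rfl
  · intro o a ha
    rw [hes] at ha
    rcases ha with ha | ⟨rfl, rfl, -⟩
    · exact hsub (h.init_of_echo o a ha)
    · rw [rcv_relayed]; exact Set.mem_insert _ _
  · intro o a ha
    rw [hre] at ha
    rw [hec, hrd]
    exact h.quorum_of_ready o a ha
  · intro o a ha
    rw [rcv_relayed, Set.mem_insert_iff] at ha
    rcases ha with ha | ha
    · obtain ⟨rfl, rfl⟩ : o = s ∧ a = it := by simpa using ha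
      by_cases hc : ∀ it' : Item n d, it'.key = a.key → Msg.echo o it' ∉ st.sent
      · exact ⟨a, rfl, (hes _ _).2 (Or.inr ⟨rfl, rfl, hc⟩)⟩
      · push Not at hc
        obtain ⟨b, hb, hb'⟩ := hc
        exact ⟨b, hb, sent_subset_relayed hb'⟩
    · obtain ⟨b, hb, hb'⟩ := h.echo_of_init o a ha
      exact ⟨b, hb, sent_subset_relayed hb'⟩
  · intro o a ha ha'
    rw [hec] at ha ha'
    obtain ⟨b, hb, hb'⟩ := h.ready_of_echoes o a ha ha'
    exact ⟨b, hb, sent_subset_relayed hb'⟩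
  · intro o a ha
    rw [hrd] at ha
    obtain ⟨b, hb, hb'⟩ := h.ready_of_readies o a ha
    exact ⟨b, hb, sent_subset_relayed hb'⟩

/-- The common part of the reactions to `echo` and `ready` messages: a `ready` message is sent if
the threshold condition `Q` is met and none was sent before. -/
theorem BroadcastInv.of_ready (h : BroadcastInv f st) {o : Fin n} {it : Item n d} {Q : Prop}
    (hsub : st.rcv ⊆ st'.rcv) (hsent : st.sent ⊆ st'.sent)
    (hini : ∀ o it', (o, Msg.init it') ∈ st'.rcv ↔ (o, Msg.init it') ∈ st.rcv)
    (hes : ∀ o it', Msg.echo o it' ∈ st'.sent ↔ Msg.echo o it' ∈ st.sent)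
    (hre : ∀ o' it', Msg.ready o' it' ∈ st'.sent ↔ Msg.ready o' it' ∈ st.sent ∨
      (o' = o ∧ it' = it ∧ Q ∧ ∀ it' : Item n d, it'.key = it.key → Msg.ready o it' ∉ st.sent))
    (hQ : Q → n - f ≤ st'.echoes o it ∨ f + 1 ≤ st'.readies o it)
    (hec : ∀ o' it', st'.echoes o' it' ≠ st.echoes o' it' →
      o' = o ∧ it' = it ∧ (n - f ≤ st'.echoes o it → Q))
    (hrd : ∀ o' it', st'.readies o' it' ≠ st.readies o' it' →
      o' = o ∧ it' = it ∧ (f + 1 ≤ st'.readies o it → Q)) : BroadcastInv f st' := by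
  -- Either the new `ready` is sent now, or an earlier one with the same key blocked it and serves
  -- instead.
  have hnew : Q → ∃ it' : Item n d, it'.key = it.key ∧ Msg.ready o it' ∈ st'.sent := by
    intro q
    by_cases hc : ∀ it' : Item n d, it'.key = it.key → Msg.ready o it' ∉ st.sent
    · exact ⟨it, rfl, (hre _ _).2 (Or.inr ⟨rfl, rfl, q, hc⟩)⟩
    · push Not at hc
      obtain ⟨b, hb, hb'⟩ := hc
      exact ⟨b, hb, hsent hb'⟩
  constructor
  · intro o a b hab ha hb
    rw [hes] at ha hb
    exact h.echo_unique o a b hab ha hb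
  · intro o a ha
    rw [hes] at ha
    exact hsub (h.init_of_echo o a ha)
  · intro o' a ha
    rcases (hre _ _).1 ha with ha | ⟨rfl, rfl, q, -⟩
    · exact (h.quorum_of_ready o' a ha).imp (fun h => h.trans (echoes_mono hsub _ _))
        fun h => h.trans (readies_mono hsub _ _)
    · exact hQ q
  · intro o a ha
    rw [hini] at ha
    obtain ⟨b, hb, hb'⟩ := h.echo_of_init o a ha
    exact ⟨b, hb, hsent hb'⟩
  · intro o' a ha ha'
    by_cases he : st'.echoes o' a = st.echoes o' a
    · rw [he] at ha ha'
      obtain ⟨b, hb, hb'⟩ := h.ready_of_echoes o' a ha ha'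
      exact ⟨b, hb, hsent hb'⟩
    · obtain ⟨rfl, rfl, hq⟩ := hec o' a he
      exact hnew (hq ha')
  · intro o' a ha
    by_cases he : st'.readies o' a = st.readies o' a
    · rw [he] at ha
      obtain ⟨b, hb, hb'⟩ := h.ready_of_readies o' a ha
      exact ⟨b, hb, hsent hb'⟩
    · obtain ⟨rfl, rfl, hq⟩ := hrd o' a he
      exact hnew (hq ha)

theorem BroadcastInv.receive_echo (h : BroadcastInv f st) (s o : Fin n) (it : Item n d) :
    BroadcastInv f (st.relayed f s (.echo o it)) := by
  -- `relay` tests the threshold after recording the message but before reacting; the count does not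
  -- depend on `sent`, so it is the same in the final state.
  have hecho : (st.relayed f s (.echo o it)).echoes o it =
      ({ st with rcv := insert (s, .echo o it) st.rcv } : LocalState n d).echoes o it := by
    simp [echoes, rcv_relayed]
  refine h.of_ready (o := o) (it := it)
    (Q := n - f ≤ (st.relayed f s (.echo o it)).echoes o it) extends_relayed.rcv
    sent_subset_relayed ?_ ?_ ?_ Or.inl ?_ ?_
  · intro o' it'; simp [rcv_relayed]
  · intro o' it'
    simp only [relayed, relay]; split_ifs <;> simp
  · intro o' it'
    rw [hecho]
    simp only [relayed, relay]
    split_ifs with hc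
    · simp only [Set.mem_insert_iff, Msg.ready.injEq]; tauto
    · tauto
  · intro o' it' hne
    by_contra hcon
    refine hne ?_
    have : ¬ (o' = o ∧ it' = it) := fun hh => hcon ⟨hh.1, hh.2, id⟩
    simp [echoes, rcv_relayed, this]
  · intro o' it' hne
    exact absurd (by simp [readies, rcv_relayed]) hne

theorem BroadcastInv.receive_ready (h : BroadcastInv f st) (s o : Fin n) (it : Item n d) :
    BroadcastInv f (st.relayed f s (.ready o it)) := by
  have hready : (st.relayed f s (.ready o it)).readies o it =
      ({ st with rcv := insert (s, .ready o it) st.rcv } : LocalState n d).readies o it := by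
    simp [readies, rcv_relayed]
  refine h.of_ready (o := o) (it := it)
    (Q := f + 1 ≤ (st.relayed f s (.ready o it)).readies o it) extends_relayed.rcv
    sent_subset_relayed ?_ ?_ ?_ Or.inr ?_ ?_
  · intro o' it'; simp [rcv_relayed]
  · intro o' it'
    simp only [relayed, relay]; split_ifs <;> simp
  · intro o' it'
    rw [hready]
    simp only [relayed, relay]
    split_ifs with hc
    · simp only [Set.mem_insert_iff, Msg.ready.injEq]; tauto
    · tauto
  · intro o' it' hne
    exact absurd (by simp [echoes, rcv_relayed]) hne
  · intro o' it' hne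
    by_contra hcon
    refine hne ?_
    have : ¬ (o' = o ∧ it' = it) := fun hh => hcon ⟨hh.1, hh.2, id⟩
    simp [readies, rcv_relayed, this]

theorem BroadcastInv.receive (h : BroadcastInv f st) : BroadcastInv f (st.receive f R s m) := by
  rw [receive_eq]
  refine BroadcastInv.progress ?_
  cases m with
  | init it => exact h.receive_init s it
  | echo o it => exact h.receive_echo s o it
  | ready o it => exact h.receive_ready s o it

/-! #### Invariants of the rounds -/

/-- Round `0` has its own clauses because its multiset consists of points computed from reports
rather than of delivered vectors. In `coll_zero`, `X` is the data listed in the report of `j`, from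
which `u` is computed. -/
structure RoundInv (f : ℕ) (R : Rule d) (st : LocalState n d) : Prop where
  value_iff : ∀ t v, Msg.init (.value t v) ∈ st.sent ↔ t ≤ st.round ∧ v = st.val t
  report_le : ∀ t A, Msg.init (.report t A) ∈ st.sent → t ≤ st.round
  report_unique : ∀ t A A', Msg.init (.report t A) ∈ st.sent →
    Msg.init (.report t A') ∈ st.sent → A = A'
  exists_report : ∀ t < st.round, ∃ A, Msg.init (.report t A) ∈ st.sent
  report_valid : ∀ t A, Msg.init (.report t A) ∈ st.sent →
    n - f ≤ A.card ∧ ∀ o ∈ A, ∃ v, st.Delivered f o (.value t v)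
  val_succ : ∀ t < st.round, st.val (t + 1) = R.point t (safeArea f (st.coll t))
  est_eq : 0 < st.round → st.est = Metric.diam ((st.coll 0).vals (st.coll 0).dom)
  delivered_of_coll : ∀ t < st.round, 0 < t → ∀ o v, st.coll t o = some v →
    st.Delivered f o (.value t v)
  exists_witnesses : ∀ t < st.round, 0 < t → ∃ W : Finset (Fin n), n - f ≤ W.card ∧
    ∀ j ∈ W, ∃ A : Finset (Fin n), st.Delivered f j (.report t A) ∧ n - f ≤ A.card ∧
      A ⊆ (st.coll t).dom
  card_coll_zero : 0 < st.round → n - f ≤ (st.coll 0).dom.card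
  coll_zero : 0 < st.round → ∀ j u, st.coll 0 j = some u → ∃ X : Coll n d,
    st.Delivered f j (.report 0 X.dom) ∧ n - f ≤ X.dom.card ∧
    (∀ o v, X o = some v → st.Delivered f o (.value 0 v)) ∧ u = R.point 0 (safeArea f X)

theorem RoundInv.of_rcv_subset (h : RoundInv f R st) (hrcv : st.rcv ⊆ st'.rcv)
    (hsent : ∀ it, Msg.init it ∈ st'.sent ↔ Msg.init it ∈ st.sent) (hround : st'.round = st.round)
    (hval : st'.val = st.val) (hcoll : st'.coll = st.coll) (hest : st'.est = st.est) :
    RoundInv f R st' where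
  value_iff t v := by rw [hsent, hround, hval]; exact h.value_iff t v
  report_le t A := by rw [hsent, hround]; exact h.report_le t A
  report_unique t A A' := by rw [hsent, hsent]; exact h.report_unique t A A'
  exists_report t := by simp only [hsent, hround]; exact h.exists_report t
  report_valid t A := by
    rw [hsent]
    exact fun hA => ⟨(h.report_valid t A hA).1, fun o ho =>
      ((h.report_valid t A hA).2 o ho).imp fun _ hv => hv.mono hrcv⟩
  val_succ t := by rw [hround, hval, hcoll]; exact h.val_succ t
  est_eq := by rw [hround, hest, hcoll]; exact h.est_eq
  delivered_of_coll t := by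
    rw [hround, hcoll]
    exact fun ht h0 o v hv => (h.delivered_of_coll t ht h0 o v hv).mono hrcv
  exists_witnesses t := by
    rw [hround, hcoll]
    intro ht h0
    obtain ⟨W, hW, hWA⟩ := h.exists_witnesses t ht h0
    refine ⟨W, hW, fun j hj => ?_⟩
    obtain ⟨A, hA, hA'⟩ := hWA j hj
    exact ⟨A, hA.mono hrcv, hA'⟩
  card_coll_zero := by rw [hround, hcoll]; exact h.card_coll_zero
  coll_zero := by
    rw [hround, hcoll]
    intro h0 j u hu
    obtain ⟨X, h1, h2, h3, h4⟩ := h.coll_zero h0 j u hu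
    exact ⟨X, h1.mono hrcv, h2, fun o v hv => (h3 o v hv).mono hrcv, h4⟩

theorem RoundInv.relayed (h : RoundInv f R st) : RoundInv f R (st.relayed f s m) :=
  h.of_rcv_subset extends_relayed.rcv (fun _ => init_mem_sent_relayed) round_relayed val_relayed
    coll_relayed est_relayed

theorem RoundInv.report (h : RoundInv f R st) (hr : ¬ st.Reported)
    (hc : n - f ≤ (st.values f st.round).dom.card) :
    RoundInv f R
      { st with sent := insert (Msg.init (.report st.round (st.values f st.round).dom)) st.sent }
    where
  value_iff t v := by simpa using h.value_iff t v
  report_le t A hA := by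
    rcases hA with hA | hA
    · simp only [Msg.init.injEq, Item.report.injEq] at hA
      exact hA.1.le
    · exact h.report_le t A hA
  report_unique t A A' hA hA' := by
    simp only [Set.mem_insert_iff, Msg.init.injEq, Item.report.injEq] at hA hA'
    rcases hA with ⟨rfl, rfl⟩ | hA <;> rcases hA' with ⟨h1, rfl⟩ | hA'
    · rfl
    · exact absurd ⟨A', hA'⟩ hr
    · subst h1; exact absurd ⟨A, hA⟩ hr
    · exact h.report_unique t A A' hA hA'
  exists_report t ht := (h.exists_report t ht).imp fun _ hA => Set.mem_insert_of_mem _ hA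
  report_valid t A hA := by
    simp only [Set.mem_insert_iff, Msg.init.injEq, Item.report.injEq] at hA
    rcases hA with ⟨rfl, rfl⟩ | hA
    · exact ⟨hc, fun o ho => mem_dom_values.1 ho⟩
    · exact h.report_valid t A hA
  val_succ := h.val_succ
  est_eq := h.est_eq
  delivered_of_coll := h.delivered_of_coll
  exists_witnesses := h.exists_witnesses
  card_coll_zero := h.card_coll_zero
  coll_zero := h.coll_zero

/-- Earlier rounds are untouched, so each clause is new only for the round being closed, where it is
read off from `current`. -/
theorem RoundInv.advance (h : RoundInv f R st) (hr : st.Reported)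
    (hc : n - f ≤ (st.witnesses f st.round).card) : RoundInv f R (st.advance f R) := by
  have hround : (st.advance f R).round = st.round + 1 := rfl
  have hval : ∀ t, t ≤ st.round → (st.advance f R).val t = st.val t :=
    (extends_advance (st := st) (f := f) (R := R)).val
  have hcoll : ∀ t, t < st.round → (st.advance f R).coll t = st.coll t :=
    (extends_advance (st := st) (f := f) (R := R)).coll
  have hcoll' : (st.advance f R).coll st.round = st.current f R := Function.update_self _ _ _
  have hval' : (st.advance f R).val (st.round + 1) =
    R.point st.round (safeArea f (st.current f R)) := Function.update_self _ _ _
  constructor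
  · intro t v
    have : Msg.init (.value t v) ∈ (st.advance f R).sent ↔
        (t = st.round + 1 ∧ v = (st.advance f R).val (st.round + 1)) ∨
          Msg.init (.value t v) ∈ st.sent := by
      rw [hval']; simp [LocalState.advance]
    rw [this, h.value_iff, hround]
    constructor
    · rintro (⟨rfl, hv⟩ | ⟨ht, hv⟩)
      · exact ⟨le_rfl, hv⟩
      · exact ⟨by omega, by rw [hval t ht, hv]⟩
    · rintro ⟨ht, hv⟩
      rcases Nat.lt_or_ge st.round t with h1 | h1
      · obtain rfl : t = st.round + 1 := by omega
        exact Or.inl ⟨rfl, hv⟩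
      · exact Or.inr ⟨h1, by rw [hv, hval t h1]⟩
  · intro t A hA
    have := h.report_le t A (by simpa [LocalState.advance] using hA)
    omega
  · intro t A A' hA hA'
    exact h.report_unique t A A' (by simpa [LocalState.advance] using hA)
      (by simpa [LocalState.advance] using hA')
  · intro t ht
    rcases Nat.lt_or_ge t st.round with h1 | h1
    · exact (h.exists_report t h1).imp fun _ hA => extends_advance.sent hA
    · obtain rfl : t = st.round := by omega
      exact hr.imp fun _ hA => extends_advance.sent hA
  · intro t A hA
    exact h.report_valid t A (by simpa [LocalState.advance] using hA)
  · intro t ht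
    rcases Nat.lt_or_ge t st.round with h1 | h1
    · rw [hval _ h1, hcoll _ h1]
      exact h.val_succ t h1
    · obtain rfl : t = st.round := by omega
      rw [hval', hcoll']
  · intro _
    rcases Nat.eq_zero_or_pos st.round with h0 | h0
    · rw [h0] at hcoll'
      rw [hcoll']
      simp [LocalState.advance, h0]
    · rw [hcoll 0 h0, extends_advance.est h0]
      exact h.est_eq h0
  · intro t ht h0 o v hv
    rcases Nat.lt_or_ge t st.round with h1 | h1
    · rw [hcoll _ h1] at hv
      exact h.delivered_of_coll t h1 h0 o v hv
    · obtain rfl : t = st.round := by omega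
      rw [hcoll', current, if_neg h0.ne'] at hv
      exact delivered_of_values hv
  · intro t ht h0
    rcases Nat.lt_or_ge t st.round with h1 | h1
    · rw [hcoll _ h1]
      exact h.exists_witnesses t h1 h0
    · obtain rfl : t = st.round := by omega
      rw [hcoll', current, if_neg h0.ne']
      exact ⟨_, hc, fun j hj => mem_witnesses.1 hj⟩
  · intro _
    rcases Nat.eq_zero_or_pos st.round with h0 | h0
    · rw [h0] at hcoll' hc
      rw [hcoll', current, if_pos h0]
      refine hc.trans (Finset.card_le_card fun j hj => ?_)
      simpa [witnesses, Coll.dom] using hj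
    · rw [hcoll 0 h0]
      exact h.card_coll_zero h0
  · intro _ j u hu
    rcases Nat.eq_zero_or_pos st.round with h0 | h0
    · rw [h0] at hcoll'
      rw [hcoll', current, if_pos h0] at hu
      obtain ⟨A, hA, rfl⟩ := Option.map_eq_some_iff.1 hu
      obtain ⟨h1, h2, h3⟩ := reportOf_eq_some hA
      have hdom := (st.values f 0).dom_restrict h3
      refine ⟨(st.values f 0).restrict A, hdom.symm ▸ h1, hdom.symm ▸ h2, fun o v hv => ?_, rfl⟩
      unfold Coll.restrict at hv
      split_ifs at hv
      exact delivered_of_values hv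
    · rw [hcoll 0 h0] at hu
      exact h.coll_zero h0 j u hu

theorem RoundInv.progress (h : RoundInv f R st) : RoundInv f R (st.progress f R) := by
  unfold LocalState.progress
  split_ifs with h1 h2 h2
  · exact h.advance h1 h2
  · exact h
  · exact h.report h1 h2
  · exact h

theorem RoundInv.receive (h : RoundInv f R st) : RoundInv f R (st.receive f R s m) :=
  h.relayed.progress

end LocalState

theorem broadcastInv_init {n d f : ℕ} {R : Rule d} (x : Vec d) :
    LocalState.BroadcastInv f ((roundProtocol n d f R).init x) := by
  constructor <;> simp +contextual [roundProtocol, LocalState.echoes, LocalState.readies]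

theorem roundInv_init {n d f : ℕ} {R : Rule d} (x : Vec d) :
    LocalState.RoundInv f R ((roundProtocol n d f R).init x) := by
  constructor <;> simp [roundProtocol]

/-! ### Executions: reliable broadcast and liveness -/

theorem exists_correct {n f : ℕ} {B Q : Finset (Fin n)} (hB : B.card ≤ f) (hQ : f < Q.card) :
    ∃ s ∈ Q, s ∉ B :=
  Finset.exists_mem_notMem_of_card_lt_card (hB.trans_lt hQ)

/-- Quorum intersection: for `n > 3f` the bound exceeds `f`, so the intersection contains a correct
agent. -/
theorem card_inter_ge {n f : ℕ} {Q Q' : Finset (Fin n)} (hQ : n - f ≤ Q.card)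
    (hQ' : n - f ≤ Q'.card) : n - 2 * f ≤ (Q ∩ Q').card := by
  have h1 := Finset.card_union_add_card_inter Q Q'
  have h2 := Finset.card_le_univ (Q ∪ Q')
  rw [Fintype.card_fin] at h2
  omega

theorem card_compl_ge {n f : ℕ} {B : Finset (Fin n)} (hB : B.card ≤ f) : n - f ≤ Bᶜ.card := by
  rw [Finset.card_compl, Fintype.card_fin]
  omega

section Execution

open LocalState

variable {n d f : ℕ} {R : Rule d} {B : Finset (Fin n)} {x : Fin n → Vec d}
  {ev : Schedule n (Msg n d)}

local notation "σ" => Protocol.state (roundProtocol n d f R) x ev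

theorem state_succ (k : ℕ) (i : Fin n) : σ (k + 1) i = σ k i ∨
    ∃ s m, ev k = some (s, i, m) ∧ σ (k + 1) i = (σ k i).receive f R s m := by
  rw [Protocol.state]
  rcases ev k with _ | ⟨s, r, m⟩
  · exact Or.inl rfl
  · by_cases hr : i = r
    · subst hr
      exact Or.inr ⟨s, m, rfl, Function.update_self _ _ _⟩
    · exact Or.inl (Function.update_of_ne hr _ _)

theorem state_succ_of_event {k : ℕ} {s i : Fin n} {m : Msg n d} (h : ev k = some (s, i, m)) :
    σ (k + 1) i = (σ k i).receive f R s m := by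
  rw [Protocol.state, h]
  exact Function.update_self _ _ _

/-- Induction along the states of an agent. -/
theorem state_induction {p : LocalState n d → Prop}
    (h0 : ∀ v, p ((roundProtocol n d f R).init v))
    (hs : ∀ st s m, p st → p (st.receive f R s m)) (k : ℕ) (i : Fin n) : p (σ k i) := by
  induction k with
  | zero => exact h0 _
  | succ k ih =>
    rcases state_succ (f := f) (R := R) (x := x) (ev := ev) k i with h | ⟨s, m, -, h⟩
    · rwa [h]
    · rw [h]; exact hs _ _ _ ih

theorem broadcastInv (k : ℕ) (i : Fin n) : BroadcastInv f (σ k i) :=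
  state_induction broadcastInv_init (fun _ _ _ h => h.receive) k i

theorem roundInv (k : ℕ) (i : Fin n) : RoundInv f R (σ k i) :=
  state_induction roundInv_init (fun _ _ _ h => h.receive) k i

theorem extends_state {k l : ℕ} (h : k ≤ l) (i : Fin n) : Extends (σ k i) (σ l i) := by
  induction l, h using Nat.le_induction with
  | base => exact Extends.refl _
  | succ l _ ih =>
    refine ih.trans ?_
    rcases state_succ (f := f) (R := R) (x := x) (ev := ev) l i with h | ⟨s, m, -, h⟩
    · rw [h]; exact Extends.refl _
    · rw [h]; exact extends_receive

theorem rcv_zero (i : Fin n) : (σ 0 i).rcv = ∅ := rfl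

theorem val_zero (k : ℕ) (i : Fin n) : (σ k i).val 0 = x i :=
  (extends_state (Nat.zero_le k) i).val 0 (Nat.zero_le _)

/-- `it` is delivered from `o` in the states with the set `r` of received messages. -/
def DeliveredIn (f : ℕ) (r : Set (Fin n × Msg n d)) (o : Fin n) (it : Item n d) : Prop :=
  2 * f + 1 ≤ (Finset.univ.filter fun j : Fin n => (j, Msg.ready o it) ∈ r).card

variable (he : (roundProtocol n d f R).IsExecution B x ev)
include he

/-- The strict gain of one step in time drives both the descent to the first `ready` message and the
liveness argument. -/
theorem sent_of_rcv_succ {k : ℕ} {s i : Fin n} (hs : s ∉ B) {m : Msg n d}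
    (h : (s, m) ∈ (σ (k + 1) i).rcv) : m ∈ (σ k s).sent := by
  induction k with
  | zero =>
    rcases state_succ (f := f) (R := R) (x := x) (ev := ev) 0 i with h' | ⟨s', m', h1, h'⟩
    · rw [h', rcv_zero] at h
      exact absurd h (Set.notMem_empty _)
    · rw [h', rcv_receive, rcv_zero, Set.mem_insert_iff] at h
      rcases h with h | h
      · obtain ⟨rfl, rfl⟩ := Prod.mk.inj h
        exact he.integrity _ _ _ _ h1 hs
      · exact absurd h (Set.notMem_empty _)
  | succ k ih =>
    have up := (extends_state (f := f) (R := R) (x := x) (ev := ev) (Nat.le_succ k) s).sent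
    rcases state_succ (f := f) (R := R) (x := x) (ev := ev) (k + 1) i with h' | ⟨s', m', h1, h'⟩
    · rw [h'] at h
      exact up (ih h)
    · rw [h', rcv_receive, Set.mem_insert_iff] at h
      rcases h with h | h
      · obtain ⟨rfl, rfl⟩ := Prod.mk.inj h
        exact he.integrity _ _ _ _ h1 hs
      · exact up (ih h)

theorem sent_of_rcv {k : ℕ} {s i : Fin n} (hs : s ∉ B) {m : Msg n d}
    (h : (s, m) ∈ (σ k i).rcv) : m ∈ (σ k s).sent :=
  sent_of_rcv_succ he hs ((extends_state (Nat.le_succ k) i).rcv h)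

open Filter in
theorem eventually_rcv {k : ℕ} {s i : Fin n} (hs : s ∉ B) (hi : i ∉ B) {m : Msg n d}
    (h : m ∈ (σ k s).sent) : ∀ᶠ l in atTop, (s, m) ∈ (σ l i).rcv := by
  obtain ⟨k', hk'⟩ := he.reliability k s i m hs hi h
  filter_upwards [eventually_ge_atTop (k' + 1)] with l hl
  refine (extends_state hl i).rcv ?_
  rw [state_succ_of_event hk', rcv_receive]
  exact Set.mem_insert _ _

open Filter in
/-- A message sent by all agents of a set of correct agents is eventually received from all of
them. -/
theorem eventually_rcv_all {Q : Finset (Fin n)} {i : Fin n} (hi : i ∉ B) {m : Msg n d}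
    (h : ∀ s ∈ Q, s ∉ B ∧ ∃ k, m ∈ (σ k s).sent) :
    ∀ᶠ l in atTop, ∀ s ∈ Q, (s, m) ∈ (σ l i).rcv := by
  rw [eventually_all_finset]
  intro s hs
  obtain ⟨hsB, k, hk⟩ := h s hs
  exact eventually_rcv he hsB hi hk

/-! ### Agreement, validity and totality of the reliable broadcast -/

variable (hB : B.card ≤ f)
include hB

/-- The first correct agent that sends a `ready` message has received a quorum of `echo`s. -/
theorem exists_echoes_of_ready {k : ℕ} {i o : Fin n} (hi : i ∉ B) {it : Item n d}
    (h : Msg.ready o it ∈ (σ k i).sent) :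
    ∃ l ≤ k, ∃ j ∉ B, n - f ≤ (σ l j).echoes o it := by
  induction k using Nat.strong_induction_on generalizing i with
  | _ k ih =>
  rcases (broadcastInv k i).quorum_of_ready o it h with h1 | h1
  · exact ⟨k, le_rfl, i, hi, h1⟩
  -- One of `f + 1` senders of `ready` is correct, and it sent its message strictly earlier.
  · obtain ⟨s, hs, hsB⟩ := exists_correct hB h1
    simp only [Finset.mem_filter, Finset.mem_univ, true_and] at hs
    cases k with
    | zero => exact absurd hs (Set.notMem_empty _)
    | succ k =>
      obtain ⟨l, hl, hl'⟩ := ih k (Nat.lt_succ_self k) hsB (sent_of_rcv_succ he hsB hs)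
      exact ⟨l, hl.trans (Nat.le_succ k), hl'⟩

variable (hn : 3 * f < n)
include hn

/-- Both items have an echo quorum; a correct agent in both quorums echoes only one item per key. -/
theorem ready_agreement {k l : ℕ} {i j o : Fin n} (hi : i ∉ B) (hj : j ∉ B) {it it' : Item n d}
    (hkey : it.key = it'.key) (h : Msg.ready o it ∈ (σ k i).sent)
    (h' : Msg.ready o it' ∈ (σ l j).sent) : it = it' := by
  obtain ⟨k₁, -, i₁, -, h₁⟩ := exists_echoes_of_ready he hB hi h
  obtain ⟨k₂, -, i₂, -, h₂⟩ := exists_echoes_of_ready he hB hj h'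
  obtain ⟨s, hs, hsB⟩ := exists_correct hB
    (show f < _ from lt_of_lt_of_le (by omega) (card_inter_ge h₁ h₂))
  simp only [Finset.mem_inter, Finset.mem_filter, Finset.mem_univ, true_and] at hs
  have e₁ := (extends_state (le_max_left k₁ k₂) s).sent (sent_of_rcv he hsB hs.1)
  have e₂ := (extends_state (le_max_right k₁ k₂) s).sent (sent_of_rcv he hsB hs.2)
  exact (broadcastInv _ s).echo_unique o it it' hkey e₁ e₂

theorem init_of_ready {k : ℕ} {i o : Fin n} (hi : i ∉ B) (ho : o ∉ B) {it : Item n d}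
    (h : Msg.ready o it ∈ (σ k i).sent) : Msg.init it ∈ (σ k o).sent := by
  obtain ⟨l, hl, j, -, h₁⟩ := exists_echoes_of_ready he hB hi h
  obtain ⟨s, hs, hsB⟩ := exists_correct hB (lt_of_lt_of_le (by omega) h₁)
  simp only [Finset.mem_filter, Finset.mem_univ, true_and] at hs
  exact (extends_state hl o).sent (sent_of_rcv he ho
    ((broadcastInv l s).init_of_echo o it (sent_of_rcv he hsB hs)))

omit hn in
theorem exists_ready_of_delivered_succ {k : ℕ} {i o : Fin n} {it : Item n d}
    (h : (σ (k + 1) i).Delivered f o it) : ∃ s ∉ B, Msg.ready o it ∈ (σ k s).sent := by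
  obtain ⟨s, hs, hsB⟩ := exists_correct hB (show f < _ from lt_of_lt_of_le (by omega) h)
  simp only [Finset.mem_filter, Finset.mem_univ, true_and] at hs
  exact ⟨s, hsB, sent_of_rcv_succ he hsB hs⟩

omit hn in
theorem exists_ready_of_delivered {k : ℕ} {i o : Fin n} {it : Item n d}
    (h : (σ k i).Delivered f o it) : ∃ s ∉ B, Msg.ready o it ∈ (σ k s).sent :=
  exists_ready_of_delivered_succ he hB (h.mono (extends_state (Nat.le_succ k) i).rcv)

/-- Agreement of the reliable broadcast. -/
theorem delivered_agreement {k l : ℕ} {i j o : Fin n} {it it' : Item n d}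
    (hkey : it.key = it'.key) (h : (σ k i).Delivered f o it) (h' : (σ l j).Delivered f o it') :
    it = it' := by
  obtain ⟨s, hs, h₁⟩ := exists_ready_of_delivered he hB h
  obtain ⟨s', hs', h₂⟩ := exists_ready_of_delivered he hB h'
  exact ready_agreement he hB hn hs hs' hkey h₁ h₂

/-- Validity of the reliable broadcast: what is delivered from a correct agent was sent by it
strictly before. -/
theorem init_of_delivered_succ {k : ℕ} {i o : Fin n} (ho : o ∉ B) {it : Item n d}
    (h : (σ (k + 1) i).Delivered f o it) : Msg.init it ∈ (σ k o).sent := by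
  obtain ⟨s, hs, h₁⟩ := exists_ready_of_delivered_succ he hB h
  exact init_of_ready he hB hn hs ho h₁

theorem init_of_delivered {k : ℕ} {i o : Fin n} (ho : o ∉ B) {it : Item n d}
    (h : (σ k i).Delivered f o it) : Msg.init it ∈ (σ k o).sent :=
  init_of_delivered_succ he hB hn ho (h.mono (extends_state (Nat.le_succ k) i).rcv)

open Filter in
-- The correct agents alone, at least `n - f ≥ 2f + 1` of them, meet the delivery threshold.
theorem eventually_delivered_of_ready {o : Fin n} {it : Item n d}
    (h : ∀ s ∉ B, ∃ k, Msg.ready o it ∈ (σ k s).sent) {i : Fin n} (hi : i ∉ B) :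
    ∀ᶠ l in atTop, (σ l i).Delivered f o it := by
  filter_upwards [eventually_rcv_all he (Q := Bᶜ) hi
    (fun s hs => ⟨Finset.mem_compl.1 hs, h s (Finset.mem_compl.1 hs)⟩)] with l hl
  have h1 := card_compl_ge hB
  have h2 : Bᶜ.card ≤ (σ l i).readies o it :=
    Finset.card_le_card fun s hs => by simpa using hl s hs
  unfold Delivered
  omega

open Filter in
/-- Totality of the reliable broadcast. -/
theorem eventually_delivered_of_delivered {k : ℕ} {j o : Fin n} {it : Item n d}
    (h : (σ k j).Delivered f o it) {i : Fin n} (hi : i ∉ B) :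
    ∀ᶠ l in atTop, (σ l i).Delivered f o it := by
  refine eventually_delivered_of_ready he hB hn (fun s hs => ?_) hi
  set Q := Finset.univ.filter fun j' : Fin n => (j', Msg.ready o it) ∈ (σ k j).rcv with hQ
  have hQc : 2 * f + 1 ≤ Q.card := h
  -- At least `f + 1` of the `2f + 1` `ready` messages come from correct agents, hence reach `s` too
  -- and make it send `ready`.
  obtain ⟨l, hl⟩ := (eventually_rcv_all he (Q := Q \ B) hs (m := Msg.ready o it) (fun s' hs' => by
    rw [Finset.mem_sdiff] at hs'
    refine ⟨hs'.2, k, sent_of_rcv he hs'.2 (i := j) ?_⟩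
    simpa [hQ] using hs'.1)).exists
  have h1 : (Q \ B).card ≤ (σ l s).readies o it :=
    Finset.card_le_card fun s hs => by simpa using hl s hs
  have h2 := Finset.le_card_sdiff B Q
  have h3 : f + 1 ≤ (σ l s).readies o it := by omega
  obtain ⟨it', hkey, hit'⟩ := (broadcastInv l s).ready_of_readies o it h3
  obtain ⟨s', hs', h₁⟩ := exists_ready_of_delivered he hB h
  obtain rfl := ready_agreement he hB hn hs hs' hkey hit' h₁
  exact ⟨l, hit'⟩

omit he hB hn in
-- This holds for every `o`, because the states of Byzantine agents also follow the protocol; only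
-- the messages received from them are arbitrary.
theorem init_unique {k l : ℕ} {o : Fin n} {it it' : Item n d} (hkey : it.key = it'.key)
    (h : Msg.init it ∈ (σ k o).sent) (h' : Msg.init it' ∈ (σ l o).sent) : it = it' := by
  replace h := (extends_state (le_max_left k l) o).sent h
  replace h' := (extends_state (le_max_right k l) o).sent h'
  have inv := roundInv (f := f) (R := R) (x := x) (ev := ev) (max k l) o
  cases it with
  | value t v =>
    cases it' with
    | value t' v' =>
      obtain rfl : t = t' := by simpa [Item.key] using hkey
      rw [((inv.value_iff _ _).1 h).2, ((inv.value_iff _ _).1 h').2]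
    | report t' A' => simp [Item.key] at hkey
  | report t A =>
    cases it' with
    | value t' v' => simp [Item.key] at hkey
    | report t' A' =>
      obtain rfl : t = t' := by simpa [Item.key] using hkey
      rw [inv.report_unique _ _ _ h h']

open Filter in
/-- What a correct agent broadcasts is eventually delivered by all correct agents. -/
theorem eventually_delivered_of_init {k : ℕ} {o : Fin n} (ho : o ∉ B) {it : Item n d}
    (h : Msg.init it ∈ (σ k o).sent) {i : Fin n} (hi : i ∉ B) :
    ∀ᶠ l in atTop, (σ l i).Delivered f o it := by
  refine eventually_delivered_of_ready he hB hn (fun s hs => ?_) hi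
  have hecho : ∀ s ∉ B, ∃ l, Msg.echo o it ∈ (σ l s).sent := by
    intro s hs
    obtain ⟨l, hl⟩ := (eventually_rcv he ho hs h).exists
    obtain ⟨it', hkey, hit'⟩ := (broadcastInv l s).echo_of_init o it hl
    obtain rfl := init_unique hkey
      (sent_of_rcv he ho ((broadcastInv l s).init_of_echo o it' hit')) h
    exact ⟨l, hit'⟩
  obtain ⟨l, hl⟩ := (eventually_rcv_all he (Q := Bᶜ) hs (m := Msg.echo o it)
    (fun s hs => ⟨Finset.mem_compl.1 hs, hecho s (Finset.mem_compl.1 hs)⟩)).exists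
  have h1 := card_compl_ge hB
  have h2 : Bᶜ.card ≤ (σ l s).echoes o it :=
    Finset.card_le_card fun s hs => by simpa using hl s hs
  have h3 : 1 ≤ (σ l s).echoes o it := by omega
  obtain ⟨it', hkey, hit'⟩ := (broadcastInv l s).ready_of_echoes o it h3 (h1.trans h2)
  obtain rfl := init_unique hkey (init_of_ready he hB hn hs ho hit') h
  exact ⟨l, hit'⟩

/-! #### Liveness -/

omit he hB hn in
/-- A property of what has been received that holds eventually, but not initially, becomes true by
the reception of some message. -/
theorem exists_receive_of_eventually {p : Set (Fin n × Msg n d) → Prop} {i : Fin n}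
    (h0 : ¬ p ∅) (h : ∃ k, p (σ k i).rcv) : ∃ k s m, p (σ (k + 1) i).rcv ∧
      σ (k + 1) i = ((σ k i).relayed f s m).progress f R := by
  have hk := Nat.find_spec h
  have hmin := @Nat.find_min _ _ h
  generalize Nat.find h = k at hk hmin
  cases k with
  | zero => exact absurd hk h0
  | succ k =>
    rcases state_succ (f := f) (R := R) (x := x) (ev := ev) k i with h' | ⟨s, m, -, h'⟩
    · exact absurd (h' ▸ hk) (hmin (Nat.lt_succ_self k))
    · exact ⟨k, s, m, hk, h'⟩

open Filter in
-- An agent acts only upon a reception, so the threshold must be met at a reception in round `t`,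
-- not merely before the round is entered. Waiting for the vectors of all correct agents, including
-- that of `i` itself, ensures this: delivery of its own vector shows that `i` had already reached
-- round `t`.
theorem exists_report_of_reached {t : ℕ} (hreach : ∀ i ∉ B, ∃ k, t ≤ (σ k i).round) {i : Fin n}
    (hi : i ∉ B) : ∃ k A, Msg.init (.report t A) ∈ (σ k i).sent := by
  have hdel : ∃ k, ∀ o ∈ Bᶜ, ∃ v, DeliveredIn f (σ k i).rcv o (.value t v) := by
    refine Eventually.exists (f := atTop) ((eventually_all_finset _).2 fun o ho => ?_)
    rw [Finset.mem_compl] at ho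
    obtain ⟨k, hk⟩ := hreach o ho
    filter_upwards [eventually_delivered_of_init he hB hn ho
      (((roundInv k o).value_iff t _).2 ⟨hk, rfl⟩) hi] with l hl
    exact ⟨_, hl⟩
  obtain ⟨k, s, m, hk, hst⟩ := exists_receive_of_eventually
    (p := fun r => ∀ o ∈ Bᶜ, ∃ v, DeliveredIn f r o (.value t v))
    (fun h => by
      obtain ⟨v, hv⟩ := h i (Finset.mem_compl.2 hi)
      simp [DeliveredIn] at hv) hdel
  obtain ⟨v, hv⟩ := hk i (Finset.mem_compl.2 hi)
  have hround := (((roundInv k i).value_iff t v).1 (init_of_delivered_succ he hB hn hi hv)).1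
  rcases hround.lt_or_eq with hlt | heq
  · exact ⟨k, (roundInv k i).exists_report t hlt⟩
  refine ⟨k + 1, ?_⟩
  have hr : ((σ k i).relayed f s m).round = t := by rw [round_relayed, heq]
  by_cases hrep : ((σ k i).relayed f s m).Reported
  · obtain ⟨A, hA⟩ := hrep
    rw [hr] at hA
    exact ⟨A, hst ▸ extends_progress.sent hA⟩
  · have hcard : n - f ≤ (((σ k i).relayed f s m).values f t).dom.card := by
      refine (card_compl_ge hB).trans (Finset.card_le_card fun o ho => ?_)
      rw [mem_dom_values]
      obtain ⟨v, hv⟩ := hk o ho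
      rw [hst, rcv_progress] at hv
      exact ⟨v, hv⟩
    rw [hst, LocalState.progress, if_neg hrep, hr, if_pos hcard]
    exact ⟨_, Set.mem_insert _ _⟩

open Filter in
/-- Correct agents reach all rounds. -/
theorem exists_round_ge (t : ℕ) : ∀ i ∉ B, ∃ k, t ≤ (σ k i).round := by
  induction t with
  | zero => exact fun i _ => ⟨0, Nat.zero_le _⟩
  | succ t ih =>
  intro i hi
  have hdel : ∃ k, ∀ j ∈ Bᶜ, ∃ A : Finset (Fin n), DeliveredIn f (σ k i).rcv j (.report t A) ∧
      n - f ≤ A.card ∧ ∀ o ∈ A, ∃ v, DeliveredIn f (σ k i).rcv o (.value t v) := by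
    refine Eventually.exists (f := atTop) ((eventually_all_finset _).2 fun j hj => ?_)
    rw [Finset.mem_compl] at hj
    obtain ⟨k, A, hA⟩ := exists_report_of_reached he hB hn ih hj
    obtain ⟨hc, hA'⟩ := (roundInv k j).report_valid t A hA
    -- Some listed agents may be Byzantine, so totality is needed: `j` has delivered their vectors.
    have h2 : ∀ᶠ l in atTop, ∀ o ∈ A, ∃ v, (σ l i).Delivered f o (.value t v) := by
      rw [eventually_all_finset]
      intro o ho
      obtain ⟨v, hv⟩ := hA' o ho
      filter_upwards [eventually_delivered_of_delivered he hB hn hv hi] with l hl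
      exact ⟨v, hl⟩
    filter_upwards [eventually_delivered_of_init he hB hn hj hA hi, h2] with l hl hl'
    exact ⟨A, hl, hc, hl'⟩
  obtain ⟨k, s, m, hk, hst⟩ := exists_receive_of_eventually
    (p := fun r => ∀ j ∈ Bᶜ, ∃ A : Finset (Fin n), DeliveredIn f r j (.report t A) ∧
      n - f ≤ A.card ∧ ∀ o ∈ A, ∃ v, DeliveredIn f r o (.value t v))
    (fun h => by
      obtain ⟨A, hv, -⟩ := h i (Finset.mem_compl.2 hi)
      simp [DeliveredIn] at hv) hdel
  -- The report of `i` itself is among those delivered, so `i` had broadcast it before this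
  -- reception, which therefore triggers the advance unless `i` is already past round `t`.
  obtain ⟨A, hA, -⟩ := hk i (Finset.mem_compl.2 hi)
  have hsent := init_of_delivered_succ he hB hn hi hA
  rcases ((roundInv k i).report_le t A hsent).lt_or_eq with hlt | heq
  · exact ⟨k, hlt⟩
  refine ⟨k + 1, ?_⟩
  have hr : ((σ k i).relayed f s m).round = t := by rw [round_relayed, heq]
  have hrep : ((σ k i).relayed f s m).Reported := ⟨A, by rw [hr]; exact sent_subset_relayed hsent⟩
  have hcard : n - f ≤ (((σ k i).relayed f s m).witnesses f t).card := by
    refine (card_compl_ge hB).trans (Finset.card_le_card fun j hj => ?_)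
    rw [mem_witnesses]
    obtain ⟨A, h1, h2, h3⟩ := hk j hj
    rw [hst, rcv_progress] at h1 h3
    exact ⟨A, h1, h2, fun o ho => mem_dom_values.2 (h3 o ho)⟩
  rw [hst, LocalState.progress, if_pos hrep, hr, if_pos hcard]
  exact (congrArg (· + 1) hr).ge

end Execution

/-! ### The vectors and multisets of an execution -/

section Trace

open LocalState

variable {n d f : ℕ} {R : Rule d} {B : Finset (Fin n)} {x : Fin n → Vec d}
  {ev : Schedule n (Msg n d)}

local notation "σ" => Protocol.state (roundProtocol n d f R) x ev

variable (f R B x ev) in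
/-- `y i t` is the vector of agent `i` at the beginning of round `t`, and `V i t` the multiset that
it uses in that round. -/
structure IsTrace (y : Fin n → ℕ → Vec d) (V : Fin n → ℕ → Coll n d) : Prop where
  val : ∀ i ∉ B, ∀ t k, t ≤ (σ k i).round → (σ k i).val t = y i t
  coll : ∀ i ∉ B, ∀ t k, t < (σ k i).round → (σ k i).coll t = V i t
  est : ∀ i ∉ B, ∀ k, 0 < (σ k i).round → (σ k i).est = Metric.diam ((V i 0).vals (V i 0).dom)
  zero : ∀ i ∉ B, y i 0 = x i
  succ : ∀ i ∉ B, ∀ t, y i (t + 1) = R.point t (safeArea f (V i t))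
  eq_of_correct : ∀ t, 1 ≤ t → ∀ i ∉ B, ∀ o ∉ B, ∀ v, V i t o = some v → v = y o t
  card_common : ∀ t, 1 ≤ t → ∀ i ∉ B, ∀ j ∉ B, n - f ≤ ((V i t).common (V j t)).card
  card_dom_zero : ∀ i ∉ B, n - f ≤ (V i 0).dom.card
  zero_agree : ∀ i ∉ B, ∀ j ∉ B, ∀ o u u', V i 0 o = some u → V j 0 o = some u' → u = u'
  zero_eq_point : ∀ i ∉ B, ∀ o u, V i 0 o = some u → ∃ X : Coll n d, n - f ≤ X.dom.card ∧
    (∀ o ∉ B, ∀ v, X o = some v → v = x o) ∧ u = R.point 0 (safeArea f X)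

theorem exists_isTrace (he : (roundProtocol n d f R).IsExecution B x ev) (hB : B.card ≤ f)
    (hn : 3 * f < n) : ∃ y V, IsTrace f R B x ev y V := by
  -- `K i t` will be some time at which `i` has reached round `t`. Recorded data never change, so
  -- any such time defines the same `y` and `V`.
  have hreach : ∀ i t, ∃ k, i ∉ B → t ≤ (σ k i).round := by
    intro i t
    by_cases hi : i ∈ B
    · exact ⟨0, fun h => absurd hi h⟩
    · exact (exists_round_ge he hB hn t i hi).imp fun _ h _ => h
  choose K hK using hreach
  have hval : ∀ i ∉ B, ∀ t k, t ≤ (σ k i).round → (σ k i).val t = (σ (K i t) i).val t := by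
    intro i hi t k hk
    rcases le_total k (K i t) with h | h
    · exact ((extends_state h i).val t hk).symm
    · exact (extends_state h i).val t (hK i t hi)
  have hcoll : ∀ i ∉ B, ∀ t k, t < (σ k i).round →
      (σ k i).coll t = (σ (K i (t + 1)) i).coll t := by
    intro i hi t k hk
    rcases le_total k (K i (t + 1)) with h | h
    · exact ((extends_state h i).coll t hk).symm
    · exact (extends_state h i).coll t (hK i (t + 1) hi)
  have agree : ∀ {k l i j o t} {v v' : Vec d}, (σ k i).Delivered f o (.value t v) →
      (σ l j).Delivered f o (.value t v') → v = v' := by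
    intro k l i j o t v v' h h'
    have := delivered_agreement he hB hn (it := .value t v) (it' := .value t v') rfl h h'
    simpa using this
  have agreeR : ∀ {k l i j o t} {A A' : Finset (Fin n)}, (σ k i).Delivered f o (.report t A) →
      (σ l j).Delivered f o (.report t A') → A = A' := by
    intro k l i j o t A A' h h'
    have := delivered_agreement he hB hn (it := .report t A) (it' := .report t A') rfl h h'
    simpa using this
  have correct : ∀ {k i o t} {v : Vec d}, o ∉ B → (σ k i).Delivered f o (.value t v) →
      v = (σ (K o t) o).val t := by
    intro k i o t v ho h
    obtain ⟨h1, h2⟩ := ((roundInv k o).value_iff t v).1 (init_of_delivered he hB hn ho h)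
    rw [h2, hval o ho t k h1]
  refine ⟨fun i t => (σ (K i t) i).val t, fun i t => (σ (K i (t + 1)) i).coll t, hval, hcoll,
    ?_, fun i _ => val_zero _ i, ?_, ?_, ?_, ?_, ?_, ?_⟩
  · intro i hi k hk
    rw [← hcoll i hi 0 k hk]
    exact (roundInv k i).est_eq hk
  · intro i hi t
    exact (roundInv (K i (t + 1)) i).val_succ t (hK i (t + 1) hi)
  · intro t ht i hi o ho v hv
    exact correct ho ((roundInv _ i).delivered_of_coll t (hK i (t + 1) hi) ht o v hv)
  · intro t ht i hi j hj
    obtain ⟨W, hW, hWA⟩ := (roundInv (f := f) (R := R) (x := x) (ev := ev) _ i).exists_witnesses t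
      (hK i (t + 1) hi) ht
    obtain ⟨W', hW', hWA'⟩ := (roundInv (f := f) (R := R) (x := x) (ev := ev) _ j).exists_witnesses t
      (hK j (t + 1) hj) ht
    -- The common witness `w` may be Byzantine: agreement on its report suffices.
    obtain ⟨w, hw⟩ := Finset.card_pos.1
      (lt_of_lt_of_le (show 0 < n - 2 * f by omega) (card_inter_ge hW hW'))
    rw [Finset.mem_inter] at hw
    obtain ⟨A, hA, hAc, hAd⟩ := hWA w hw.1
    obtain ⟨A', hA', -, hAd'⟩ := hWA' w hw.2
    obtain rfl := agreeR hA hA'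
    refine hAc.trans (Finset.card_le_card fun o ho => ?_)
    obtain ⟨v, hv⟩ := Coll.mem_dom.1 (hAd ho)
    obtain ⟨v', hv'⟩ := Coll.mem_dom.1 (hAd' ho)
    obtain rfl := agree ((roundInv _ i).delivered_of_coll t (hK i (t + 1) hi) ht o v hv)
      ((roundInv _ j).delivered_of_coll t (hK j (t + 1) hj) ht o v' hv')
    exact Coll.mem_common.2 ⟨v, hv, hv'⟩
  · intro i hi
    exact (roundInv _ i).card_coll_zero (hK i 1 hi)
  · intro i hi j hj o u u' hu hu'
    obtain ⟨X, hX, -, hXv, rfl⟩ := (roundInv _ i).coll_zero (hK i 1 hi) o u hu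
    obtain ⟨X', hX', -, hXv', rfl⟩ := (roundInv _ j).coll_zero (hK j 1 hj) o u' hu'
    -- Agreement on the report fixes the domain and agreement on the vectors fixes the entries, so
    -- both agents compute the same point for `o`.
    have hdom := agreeR hX hX'
    have : X = X' := by
      funext a
      rcases ha : X a with _ | v
      · rcases ha' : X' a with _ | v'
        · rfl
        · have : a ∈ X.dom := hdom ▸ Coll.mem_dom.2 ⟨v', ha'⟩
          obtain ⟨v, hv⟩ := Coll.mem_dom.1 this
          simp [hv] at ha
      · have : a ∈ X'.dom := hdom ▸ Coll.mem_dom.2 ⟨v, ha⟩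
        obtain ⟨v', hv'⟩ := Coll.mem_dom.1 this
        rw [hv', agree (hXv a v ha) (hXv' a v' hv')]
    rw [this]
  · intro i hi o u hu
    obtain ⟨X, -, hXc, hXv, rfl⟩ := (roundInv _ i).coll_zero (hK i 1 hi) o u hu
    refine ⟨X, hXc, fun o ho v hv => ?_, rfl⟩
    rw [correct ho (hXv o v hv), val_zero]

variable {y : Fin n → ℕ → Vec d} {V : Fin n → ℕ → Coll n d}

theorem IsTrace.decision_eq (h : IsTrace f R B x ev y V) {i : Fin n} (hi : i ∉ B) (k : ℕ) :
    (roundProtocol n d f R).decision (σ k i) =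
      if 1 + R.rounds (Metric.diam ((V i 0).vals (V i 0).dom)) ≤ (σ k i).round
      then some (y i (1 + R.rounds (Metric.diam ((V i 0).vals (V i 0).dom)))) else none := by
  change (if _ then _ else _) = _
  -- In round `0` the estimate still has its default value, but no decision is possible because of
  -- the summand `1`.
  rcases Nat.eq_zero_or_pos (σ k i).round with h0 | h0
  · rw [if_neg (by omega), if_neg (by omega)]
  · rw [h.est i hi k h0]
    split_ifs with hr
    · rw [h.val i hi _ k hr]
    · rfl

end Trace

/-! ### Contraction -/

section MidExtremes

variable {n d f : ℕ} {B : Finset (Fin n)} {x : Fin n → Vec d} {ev : Schedule n (Msg n d)}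
  {sel : Set (Vec d) → Vec d × Vec d} {ε : ℝ} {y : Fin n → ℕ → Vec d} {V : Fin n → ℕ → Coll n d}

theorem correctDiam_eq_diam_convexHull (B : Finset (Fin n)) (z : Fin n → Vec d) :
    correctDiam B z = Metric.diam (convexHull ℝ (z '' {i | i ∉ B})) :=
  (convexHull_diam _).symm

theorem isBounded_convexHull_correct (B : Finset (Fin n)) (z : Fin n → Vec d) :
    Bornology.IsBounded (convexHull ℝ (z '' {i | i ∉ B})) :=
  isBounded_convexHull.2 (Set.toFinite _).isBounded

theorem mem_convexHull_correct {z : Fin n → Vec d} {i : Fin n} (hi : i ∉ B) :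
    z i ∈ convexHull ℝ (z '' {i | i ∉ B}) :=
  subset_convexHull ℝ _ ⟨i, hi, rfl⟩

theorem correctDiam_nonneg (z : Fin n → Vec d) : 0 ≤ correctDiam B z := Metric.diam_nonneg

theorem correctDiam_le_of_forall {z : Fin n → Vec d} {C : ℝ} (hC : 0 ≤ C)
    (h : ∀ i ∉ B, ∀ j ∉ B, dist (z i) (z j) ≤ C) : correctDiam B z ≤ C := by
  refine Metric.diam_le_of_forall_dist_le hC ?_
  rintro _ ⟨i, hi, rfl⟩ _ ⟨j, hj, rfl⟩
  exact h i hi j hj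

theorem correctDiam_le_diam {z : Fin n → Vec d} {s : Set (Vec d)} (hs : Bornology.IsBounded s)
    (h : ∀ i ∉ B, z i ∈ s) : correctDiam B z ≤ Metric.diam s :=
  correctDiam_le_of_forall Metric.diam_nonneg fun i hi j hj =>
    Metric.dist_le_diam_of_mem hs (h i hi) (h j hj)

variable (h : IsTrace f (midExtremes sel ε) B x ev y V) (hsel : IsDiamSelector sel)
  (hn : (d + 2) * f < n) (hB : B.card ≤ f)
include h

theorem IsTrace.safeArea_subset (hB : B.card ≤ f) {t : ℕ} (ht : 1 ≤ t) {i : Fin n} (hi : i ∉ B) :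
    safeArea f (V i t) ⊆ convexHull ℝ ((fun o => y o t) '' {o | o ∉ B}) :=
  safeArea_subset_of_correct hB fun o ho v hv =>
    ⟨o, ho, (h.eq_of_correct t ht i hi o ho v hv).symm⟩

include hn

theorem IsTrace.safeArea_nonempty {t : ℕ} {i : Fin n} (hi : i ∉ B) :
    (safeArea f (V i t)).Nonempty := by
  refine ByzMP.safeArea_nonempty hn ?_
  rcases Nat.eq_zero_or_pos t with rfl | ht
  · exact h.card_dom_zero i hi
  · exact (h.card_common t ht i hi i hi).trans (Finset.card_le_card (Coll.common_subset_dom _ _))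

include hsel

theorem IsTrace.mem_safeArea {t : ℕ} {i : Fin n} (hi : i ∉ B) :
    y i (t + 1) ∈ safeArea f (V i t) := by
  rw [h.succ i hi t]
  exact midpoint_selector_mem hsel (isCompact_safeArea _) (h.safeArea_nonempty hn hi)
    (convex_safeArea _)

/-- After the initial round the vectors of all correct agents lie in the convex hull of the
points from which any correct agent `i` estimates the diameter. -/
theorem IsTrace.one_mem_convexHull {i j : Fin n} (hi : i ∉ B) (hj : j ∉ B) :
    y j 1 ∈ convexHull ℝ ((V i 0).vals (V i 0).dom) := by
  have hmem := h.mem_safeArea hsel hn (t := 0) hj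
  -- At most `f` agents are missing from the domain of `V i 0`, so the safe area of `V j 0` lies in
  -- the hull of the entries shared with `V i 0`.
  refine convexHull_mono ?_ (safeArea_subset_convexHull (T := (V j 0).dom ∩ (V i 0).dom)
    Finset.inter_subset_left ?_ hmem)
  · rintro v ⟨o, ho, hv⟩
    rw [Finset.mem_inter] at ho
    obtain ⟨v', hv'⟩ := Coll.mem_dom.1 ho.2
    exact ⟨o, ho.2, h.zero_agree i hi j hj o v' v hv' hv ▸ hv'⟩
  · have h1 := Finset.card_union_add_card_inter (V j 0).dom (V i 0).dom
    have h2 := Finset.card_le_univ ((V j 0).dom ∪ (V i 0).dom)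
    rw [Fintype.card_fin] at h2
    have h3 := h.card_dom_zero i hi
    omega

theorem IsTrace.correctDiam_one_le {i : Fin n} (hi : i ∉ B) :
    correctDiam B (fun j => y j 1) ≤ Metric.diam ((V i 0).vals (V i 0).dom) := by
  rw [← convexHull_diam]
  exact correctDiam_le_diam (isBounded_convexHull.2 (Coll.finite_vals _ _).isBounded)
    fun j hj => h.one_mem_convexHull hsel hn hi hj

include hB

/-- Even a Byzantine witness contributes a point of a genuine safe area, computed by the receiver
from reliably delivered inputs. -/
theorem IsTrace.zero_mem_convexHull {i : Fin n} (hi : i ∉ B) {o : Fin n} {u : Vec d}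
    (hu : V i 0 o = some u) : u ∈ convexHull ℝ (x '' {o | o ∉ B}) := by
  obtain ⟨X, hX, hX', rfl⟩ := h.zero_eq_point i hi o u hu
  have hsub : safeArea f X ⊆ convexHull ℝ (x '' {o | o ∉ B}) :=
    safeArea_subset_of_correct hB fun o ho v hv => ⟨o, ho, (hX' o ho v hv).symm⟩
  exact hsub (midpoint_selector_mem hsel (isCompact_safeArea _) (ByzMP.safeArea_nonempty hn hX)
      (convex_safeArea _))

theorem IsTrace.estimate_le {i : Fin n} (hi : i ∉ B) :
    Metric.diam ((V i 0).vals (V i 0).dom) ≤ correctDiam B x := by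
  rw [correctDiam_eq_diam_convexHull]
  refine Metric.diam_mono ?_ (isBounded_convexHull_correct B x)
  rintro u ⟨o, -, hu⟩
  exact h.zero_mem_convexHull hsel hn hB hi hu

/-- From round 1 on, every new vector lies in a safe area and thus in the hull of the previous
correct vectors. -/
theorem IsTrace.convexHull_antitone {s t : ℕ} (hs : 1 ≤ s) (hst : s ≤ t) :
    convexHull ℝ ((fun o => y o t) '' {o | o ∉ B}) ⊆
      convexHull ℝ ((fun o => y o s) '' {o | o ∉ B}) := by
  induction t, hst using Nat.le_induction with
  | base => exact subset_rfl
  | succ t hst ih =>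
    refine (convexHull_min ?_ (convex_convexHull ℝ _)).trans ih
    rintro _ ⟨i, hi, rfl⟩
    exact h.safeArea_subset hB (hs.trans hst) hi (h.mem_safeArea hsel hn hi)

theorem IsTrace.mem_convexHull_inputs {t : ℕ} (ht : 1 ≤ t) {i : Fin n} (hi : i ∉ B) :
    y i t ∈ convexHull ℝ (x '' {o | o ∉ B}) := by
  have h1 := h.convexHull_antitone hsel hn hB le_rfl ht
    (mem_convexHull_correct (z := fun o => y o t) hi)
  refine convexHull_min ?_ (convex_convexHull ℝ _) h1
  rintro _ ⟨j, hj, rfl⟩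
  refine convexHull_min ?_ (convex_convexHull ℝ _) (h.one_mem_convexHull hsel hn hj hj)
  rintro u ⟨o, -, hu⟩
  exact h.zero_mem_convexHull hsel hn hB hj hu

theorem IsTrace.correctDiam_succ_le {t : ℕ} (ht : 1 ≤ t) :
    correctDiam B (fun i => y i (t + 1)) ≤
      Real.sqrt (7 / 8) * correctDiam B (fun i => y i t) := by
  refine correctDiam_le_of_forall (mul_nonneg (Real.sqrt_nonneg _) (correctDiam_nonneg _)) ?_
  intro i hi j hj
  obtain ⟨c, hc, hc'⟩ := safeArea_inter_nonempty hn (h.card_common t ht i hi j hj)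
  obtain ⟨h1, h2, h3⟩ := hsel _ (isCompact_safeArea _) (h.safeArea_nonempty hn (t := t) hi)
  obtain ⟨h1', h2', h3'⟩ := hsel _ (isCompact_safeArea _) (h.safeArea_nonempty hn (t := t) hj)
  rw [h.succ i hi t, h.succ j hj t, correctDiam_eq_diam_convexHull]
  exact dist_midpoint_le (isBounded_convexHull_correct B _) (h.safeArea_subset hB ht hi)
    (h.safeArea_subset hB ht hj) h1 h2 h1' h2' h3 h3' hc hc'

theorem IsTrace.correctDiam_le_pow (s : ℕ) :
    correctDiam B (fun i => y i (1 + s)) ≤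
      Real.sqrt (7 / 8) ^ s * correctDiam B (fun i => y i 1) := by
  induction s with
  | zero => simp
  | succ s ih =>
    calc correctDiam B (fun i => y i (1 + (s + 1)))
        ≤ Real.sqrt (7 / 8) * correctDiam B (fun i => y i (1 + s)) :=
          h.correctDiam_succ_le hsel hn hB (Nat.le_add_right _ _)
      _ ≤ Real.sqrt (7 / 8) * (Real.sqrt (7 / 8) ^ s * correctDiam B (fun i => y i 1)) := by gcongr
      _ = _ := by ring

/-- `D` is left free because it is used both for the estimate of an agent and for `Δ`. Beyond the
round where the contraction reaches `ε`, nested hulls suffice. -/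
theorem IsTrace.correctDiam_le (hε : 0 < ε) {D : ℝ} (hD : correctDiam B (fun i => y i 1) ≤ D)
    {t : ℕ} (ht : 1 + midRounds ε D ≤ t) : correctDiam B (fun i => y i t) ≤ ε := by
  have h1 : correctDiam B (fun i => y i t) ≤ correctDiam B (fun i => y i (1 + midRounds ε D)) := by
    rw [correctDiam_eq_diam_convexHull B fun i => y i (1 + midRounds ε D)]
    exact correctDiam_le_diam (isBounded_convexHull_correct B _) fun i hi =>
      h.convexHull_antitone hsel hn hB (by omega) ht (mem_convexHull_correct hi)
  calc _ ≤ _ := h1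
    _ ≤ _ := h.correctDiam_le_pow hsel hn hB _
    _ ≤ Real.sqrt (7 / 8) ^ midRounds ε D * D := by gcongr
    _ ≤ ε := pow_midRounds_mul_le hε

/-- Vectors of two correct agents are `ε`-close once one of them has run for the number of rounds
that it estimated. -/
theorem IsTrace.dist_le (hε : 0 < ε) {i j : Fin n} (hi : i ∉ B) (hj : j ∉ B) {s : ℕ}
    (hs : 1 + midRounds ε (Metric.diam ((V i 0).vals (V i 0).dom)) ≤ s) :
    dist (y i (1 + midRounds ε (Metric.diam ((V i 0).vals (V i 0).dom)))) (y j s) ≤ ε := by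
  set r := 1 + midRounds ε (Metric.diam ((V i 0).vals (V i 0).dom))
  refine le_trans ?_ (h.correctDiam_le hsel hn hB hε
    (h.correctDiam_one_le hsel hn hi) (t := r) le_rfl)
  rw [correctDiam_eq_diam_convexHull]
  exact Metric.dist_le_diam_of_mem (isBounded_convexHull_correct B _)
    (mem_convexHull_correct (z := fun o => y o r) hi)
    (h.convexHull_antitone hsel hn hB (Nat.le_add_right _ _) hs
      (mem_convexHull_correct (z := fun o => y o s) hj))

end MidExtremes

/-! ### Approximate consensus and the round complexities -/

theorem three_mul_lt {n d f : ℕ} (hd : 1 ≤ d) (hn : (d + 2) * f < n) : 3 * f < n :=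
  lt_of_le_of_lt (Nat.mul_le_mul_right f (by omega)) hn

theorem midExtremes_solvesApproxConsensus {n d f : ℕ} (hd : 1 ≤ d) (hn : (d + 2) * f < n)
    {ε : ℝ} (hε : 0 < ε) {sel : Set (Vec d) → Vec d × Vec d} (hsel : IsDiamSelector sel) :
    (roundProtocol n d f (midExtremes sel ε)).SolvesApproxConsensus f ε := by
  intro B hB x ev he
  have hn3 := three_mul_lt hd hn
  obtain ⟨y, V, h⟩ := exists_isTrace he hB hn3
  refine ⟨fun i hi => ?_, fun i hi k l v hkl hv => ?_, fun i hi j hj k l v w hv hw => ?_,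
    fun i hi k v hv => ?_⟩
  · obtain ⟨k, hk⟩ := exists_round_ge he hB hn3
      (1 + (midExtremes sel ε).rounds (Metric.diam ((V i 0).vals (V i 0).dom))) i hi
    exact ⟨k, _, by rw [h.decision_eq hi, if_pos hk]⟩
  · rw [h.decision_eq hi] at hv ⊢
    split_ifs at hv with hr
    rw [if_pos (hr.trans (extends_state hkl i).round), hv]
  · rw [h.decision_eq hi] at hv
    rw [h.decision_eq hj] at hw
    split_ifs at hv hw
    obtain rfl := Option.some.inj hv
    obtain rfl := Option.some.inj hw
    rw [← dist_eq_norm]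
    -- The earlier decider fixes the round at which the hull is already `ε`-small.
    rcases le_total (1 + midRounds ε (Metric.diam ((V i 0).vals (V i 0).dom)))
      (1 + midRounds ε (Metric.diam ((V j 0).vals (V j 0).dom))) with hle | hle
    · exact h.dist_le hsel hn hB hε hi hj hle
    · rw [dist_comm]
      exact h.dist_le hsel hn hB hε hj hi hle
  · rw [h.decision_eq hi] at hv
    split_ifs at hv
    obtain rfl := Option.some.inj hv
    exact h.mem_convexHull_inputs hsel hn hB (Nat.le_add_right _ _) hi

end ByzMP

end
theorem mainTheorem3 (n d f : ℕ) (hd : 1 ≤ d) (hn : (d + 2) * f < n) (ε : ℝ) (hε : 0 < ε)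
    (sel : Set (Vec d) → Vec d × Vec d) (hsel : IsDiamSelector sel) :
    -- the variant with the midpoint of a diameter-realizing pair solves approximate consensus
    (roundProtocol n d f (midExtremes sel ε)).SolvesApproxConsensus f ε ∧
    -- in each of its executions there are vectors `y i t` (agent `i`, beginning of round `t`) and
    -- multisets `V i t` (used by `i` in round `t`) with the following properties
    (∀ B : Finset (Fin n), B.card ≤ f → ∀ (x : Fin n → Vec d) (ev : Schedule n (Msg n d)),
      (roundProtocol n d f (midExtremes sel ε)).IsExecution B x ev →
      ∃ (y : Fin n → ℕ → Vec d) (V : Fin n → ℕ → Coll n d),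
        -- correct agents reach all rounds, with vectors `y` and multisets `V`
        (∀ i ∉ B, ∀ t, ∃ k,
          t ≤ ((roundProtocol n d f (midExtremes sel ε)).state x ev k i).round) ∧
        (∀ i ∉ B, ∀ t k,
          t ≤ ((roundProtocol n d f (midExtremes sel ε)).state x ev k i).round →
          ((roundProtocol n d f (midExtremes sel ε)).state x ev k i).val t = y i t) ∧
        (∀ i ∉ B, ∀ t k,
          t < ((roundProtocol n d f (midExtremes sel ε)).state x ev k i).round →
          ((roundProtocol n d f (midExtremes sel ε)).state x ev k i).coll t = V i t) ∧
        (∀ i ∉ B, y i 0 = x i) ∧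
        -- round structure, safe areas and update
        (∀ t, 1 ≤ t → ∀ i ∉ B,
          (∀ o ∉ B, ∀ v, V i t o = some v → v = y o t) ∧
          (∀ j ∉ B, n - f ≤ ((V i t).common (V j t)).card) ∧
          safeArea f (V i t) ⊆ convexHull ℝ ((fun o => y o t) '' {o | o ∉ B}) ∧
          (∀ j ∉ B, (safeArea f (V i t) ∩ safeArea f (V j t)).Nonempty) ∧
          ∃ a ∈ safeArea f (V i t), ∃ b ∈ safeArea f (V i t),
            dist a b = Metric.diam (safeArea f (V i t)) ∧ y i (t + 1) = midpoint ℝ a b) ∧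
        -- the initial round does not increase the diameter of the vectors of correct agents,
        -- every further round contracts it by `√(7/8)`
        correctDiam B (fun i => y i 1) ≤ correctDiam B x ∧
        (∀ t, 1 ≤ t → correctDiam B (fun i => y i (t + 1)) ≤
          Real.sqrt (7 / 8) * correctDiam B (fun i => y i t)) ∧
        -- hence it is at most `ε` after the initial round and `⌈log_{√(8/7)} (Δ/ε)⌉` further ones
        (∀ t, 1 + ⌈Real.logb (Real.sqrt (8 / 7)) (correctDiam B x / ε)⌉₊ ≤ t →
          correctDiam B (fun i => y i t) ≤ ε) ∧
        -- and all correct agents decide within that number of rounds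
        (∀ i ∉ B, ∃ r, 1 ≤ r ∧
          r ≤ 1 + ⌈Real.logb (Real.sqrt (8 / 7)) (correctDiam B x / ε)⌉₊ ∧
          ∀ k, r ≤ ((roundProtocol n d f (midExtremes sel ε)).state x ev k i).round →
            (roundProtocol n d f (midExtremes sel ε)).decision
              ((roundProtocol n d f (midExtremes sel ε)).state x ev k i) = some (y i r))) ∧
    -- the coordinate-wise Mendes–Herlihy algorithm, for any valid bound `D` on the initial
    -- diameter, needs `Ω(d log (dΔ/ε))` rounds until any correct agent decides
    (∀ (c : ℕ → Set (Vec d) → Vec d), IsCoordSelector c → ∀ D : ℝ,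
      ∀ B : Finset (Fin n), B.card ≤ f → ∀ (x : Fin n → Vec d) (ev : Schedule n (Msg n d)),
      correctDiam B x ≤ D → ε ≤ correctDiam B x →
      (roundProtocol n d f (mendesHerlihy c ε D)).IsExecution B x ev →
      ∀ i ∉ B,
        (∃ k, ((roundProtocol n d f (mendesHerlihy c ε D)).decision
          ((roundProtocol n d f (mendesHerlihy c ε D)).state x ev k i)).isSome) ∧
        ∀ k, ((roundProtocol n d f (mendesHerlihy c ε D)).decision
            ((roundProtocol n d f (mendesHerlihy c ε D)).state x ev k i)).isSome →
          1 / 2 * (d * Real.logb 2 (d * correctDiam B x / ε)) ≤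
            ((roundProtocol n d f (mendesHerlihy c ε D)).state x ev k i).round) := by
  have hn3 := three_mul_lt hd hn
  refine ⟨midExtremes_solvesApproxConsensus hd hn hε hsel, ?_, ?_⟩
  · intro B hB x ev he
    obtain ⟨y, V, h⟩ := exists_isTrace he hB hn3
    -- The estimate of any correct agent lies between `δ(1)` and `Δ`.
    obtain ⟨i₀, -, hi₀⟩ := exists_correct (Q := Finset.univ) hB
      (by rw [Finset.card_univ, Fintype.card_fin]; omega)
    have hone : correctDiam B (fun i => y i 1) ≤ correctDiam B x :=
      (h.correctDiam_one_le hsel hn hi₀).trans (h.estimate_le hsel hn hB hi₀)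
    refine ⟨y, V, fun i hi t => exists_round_ge he hB hn3 t i hi, h.val, h.coll, h.zero, ?_, hone,
      fun t ht => h.correctDiam_succ_le hsel hn hB ht,
      fun t ht => h.correctDiam_le hsel hn hB hε hone ht, ?_⟩
    · intro t ht i hi
      obtain ⟨h1, h2, h3⟩ := hsel _ (isCompact_safeArea _) (h.safeArea_nonempty hn (t := t) hi)
      exact ⟨h.eq_of_correct t ht i hi, h.card_common t ht i hi, h.safeArea_subset hB ht hi,
        fun j hj => safeArea_inter_nonempty hn (h.card_common t ht i hi j hj),
        _, h1, _, h2, h3, h.succ i hi t⟩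
    · intro i hi
      refine ⟨1 + midRounds ε (Metric.diam ((V i 0).vals (V i 0).dom)), Nat.le_add_right _ _,
        Nat.add_le_add_left
          (midRounds_mono hε Metric.diam_nonneg (h.estimate_le hsel hn hB hi)) 1, fun k hk => ?_⟩
      rw [h.decision_eq hi]
      exact if_pos hk
  · intro c _ D B hB x ev hD hΔ he i hi
    obtain ⟨y, V, h⟩ := exists_isTrace he hB hn3
    refine ⟨?_, fun k hk => ?_⟩
    · obtain ⟨k, hk⟩ := exists_round_ge he hB hn3 (1 + d * coordRounds d ε D) i hi
      refine ⟨k, ?_⟩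
      rw [h.decision_eq hi]
      exact (congrArg Option.isSome (if_pos hk)).trans rfl
    · rw [h.decision_eq hi] at hk
      split_ifs at hk with hr
      -- The decision round is `1 + d * coordRounds d ε D`; the initial round is dropped from the
      -- bound.
      · refine (half_mul_logb_le_coordRounds hd hε hΔ hD).trans (Nat.cast_le.2 ?_)
        exact (Nat.le_add_left _ 1).trans hr
      · exact absurd hk (by simp)
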